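/- Let $k\ge 0$, $N=2k+1$, and let $C_N=\{\alpha_0,\dots,\alpha_{N-1}\}$ be the $N$-cycle, i.e. the metric space of $N$ points with $d(\alpha_i,\alpha_j)=2\min\{|j-i|,\,N-|j-i|\}$; put $\alpha_N=\alpha_0$ (the formula stays valid for indices in $\{0,\dots,N\}$). **Injective hull.** Let $\Delta(C_N)=\{g\in\mathbb R^{C_N} : g(x)+g(y)\ge d(x,y)\ \forall x,y\in C_N\}$ and let $\operatorname{E}(C_N)$ be the set of those $g\in\Delta(C_N)$ such that for every $x$ there is a $y$ (possibly $y=x$) with $g(x)+g(y)=d(x,y)$. This is a polyhedral complex: its $v$-faces are the nonempty $v$-dimensional faces of the polyhedron $\Delta(C_N)$ that are contained in $\operatorname{E}(C_N)$, and its vertices are the points that form its $0$-faces. **Partitions.** Let $\mathbb Y_N$ be the set of integer partitions $\lambda=(\lambda_1,\dots,\lambda_m)$ that are empty or satisfy $\lambda_1+m-1<N$ (maximal hook length less than $N$), ordered by inclusion of Young diagrams. Let $\tau:\mathbb Y_N\to\mathbb Y_N$ be given by $\tau(\lambda)=(N-m-1,\lambda_1-1,\dots,\lambda_m-1)$ with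 trailing zeros removed. (For $\lambda=()$ we put $m=0$, $\lambda_1=0$.) **Outer rims.** The discrete Möbius strip $\mathfrak X_N$ is the set of positions $(i,j)$, $0\le i\le j\le N$, with $(i,N)$ identified with $(0,i)$ for $0\le i\le N$; its elements are called sites. Place the box of $\lambda\in\mathbb Y_N$ in row $r$ and column $c$ (both counted from $0$) at the position $(c,N-r)$. The outer rim $\mathcal L_\lambda\subseteq\mathfrak X_N$ is the set of sites of those positions $(i,j)$ that are not occupied by a box of $\lambda$ and for which (a) $i=0$, or $j=N$, or $(i-1,j+1)$ is occupied by a box of $\lambda$; (b) if $i=0$ then $j\ge\lambda_1$; (c) if $j=N$ then $i\le N-m$. Let $\mathfrak X_N^\circ=\{(i,j)\in\mathfrak X_N : d(\alpha_i,\alpha_j)\ge 2(k-1)\}$ and $\mathbb Y_N^\circ=\{\lambda\in\mathbb Y_N : \mathcal L_\lambda\subseteq\mathfrak X_N^\circ\}$. **Theorem.** 1. For every $\lambda\in\mathbb Y_N^\circ$ the outer rim $\mathcal L_\lambda$ consists of exactly $N$ sites, and the linear system $g(\alpha_i)+g(\alpha_j)=d(\alpha_i,\alpha_j)$ for $(i,j)\in\mathcal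 L_\lambda$ has exactly one solution $g_\lambda\in\mathbb R^{C_N}$, namely $g_\lambda(\alpha_j)=|\tau^j(\lambda)|-\tfrac12k(k-1)$ for $j=0,\dots,N-1$. 2. The map $\lambda\mapsto g_\lambda$ is a bijection from $\mathbb Y_N^\circ$ onto the set of vertices of $\operatorname{E}(C_N)$. 3. If $\lambda,\lambda'\in\mathbb Y_N^\circ$ and $\lambda'$ is obtained from $\lambda$ by removing $v$ inner corners (boxes of $\lambda$ without right and lower neighbour), then the interval $[\lambda',\lambda]$ is contained in $\mathbb Y_N^\circ$ and has $2^v$ elements, and the functions $g_\nu$, $\nu\in[\lambda',\lambda]$, are $2^v$ distinct vertices. 4. For every $v\ge0$, the $v$-faces of $\operatorname{E}(C_N)$ are exactly the convex hulls of the sets $\{g_\nu : \nu\in[\lambda',\lambda]\}$, where $\lambda,\lambda'\in\mathbb Y_N^\circ$ and $\lambda'$ is obtained from $\lambda$ by removing $v$ inner corners. The set $\operatorname{E}(C_N)$ is the union of all these faces. -/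

import Mathlib

/-! ### Partitions with bounded hook lengths and their cyclic action

Partitions are Young diagrams; the box `(r, c)` lies in row `r` and column `c`, both counted
from `0`. So `μ.rowLen 0` is the first part of `μ` and `μ.colLen 0` is its number of parts. -/

/-- The maximal hook length: first part plus number of parts minus one, and `0` for the empty
partition (where the subtraction truncates to `0`). -/
def maxHook (μ : YoungDiagram) : ℕ := μ.rowLen 0 + μ.colLen 0 - 1

/-- `𝕐_N`, the set of partitions with maximal hook length strictly smaller than `N`. -/
def YN (N : ℕ) : Set YoungDiagram := {μ | maxHook μ < N}

/-- The Young diagram with rows `N - m - 1, μ₁ - 1, …, μ_m - 1`, where `m` is the number of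
parts of `μ`. -/
def tauDiagram (N : ℕ) (μ : YN N) : YoungDiagram where
  cells :=
    (Finset.range (N - μ.1.colLen 0 - 1)).image (fun c => (0, c)) ∪
      (μ.1.cells.filter (fun b => 1 ≤ b.2)).image (fun b => (b.1 + 1, b.2 - 1))
  isLowerSet := by
    have key : ∀ r c : ℕ, ((r, c) ∈ (Finset.range (N - μ.1.colLen 0 - 1)).image
        (fun c => ((0 : ℕ), c)) ∪ (μ.1.cells.filter (fun b => 1 ≤ b.2)).image
          (fun b => (b.1 + 1, b.2 - 1))) ↔
        (r = 0 ∧ c < N - μ.1.colLen 0 - 1) ∨ (∃ r', r = r' + 1 ∧ (r', c + 1) ∈ μ.1) := by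
      intro r c
      simp only [Finset.mem_union, Finset.mem_image, Finset.mem_range, Finset.mem_filter,
        YoungDiagram.mem_cells, Prod.mk.injEq, Prod.exists]
      constructor
      · rintro (⟨a, ha, rfl, rfl⟩ | ⟨a, b, ⟨hab, hb⟩, rfl, rfl⟩)
        · exact Or.inl ⟨rfl, ha⟩
        · refine Or.inr ⟨a, rfl, ?_⟩
          simpa [Nat.sub_add_cancel hb] using hab
      · rintro (⟨rfl, h⟩ | ⟨r', rfl, h⟩)
        · exact Or.inl ⟨c, h, rfl, rfl⟩
        · exact Or.inr ⟨r', c + 1, ⟨h, by omega⟩, rfl, by omega⟩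
    rintro ⟨r, c⟩ ⟨s, d⟩ hle hmem
    have h1 : s ≤ r := hle.1
    have h2 : d ≤ c := hle.2
    rw [Finset.mem_coe, key] at hmem ⊢
    rcases hmem with ⟨rfl, h⟩ | ⟨r', rfl, h⟩
    · exact Or.inl ⟨by omega, by omega⟩
    · rcases s with _ | s
      · left
        have h3 : (0, c + 1) ∈ μ.1 := μ.1.up_left_mem (Nat.zero_le _) le_rfl h
        rw [YoungDiagram.mem_iff_lt_rowLen] at h3
        have h4 : μ.1.rowLen 0 + μ.1.colLen 0 - 1 < N := μ.2
        exact ⟨rfl, by omega⟩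
      · right
        exact ⟨s, rfl, μ.1.up_left_mem (by omega) (by omega) h⟩

theorem mem_tauDiagram {N : ℕ} (μ : YN N) (r c : ℕ) :
    (r, c) ∈ tauDiagram N μ ↔
      (r = 0 ∧ c < N - μ.1.colLen 0 - 1) ∨ (∃ r', r = r' + 1 ∧ (r', c + 1) ∈ μ.1) := by
  rw [← YoungDiagram.mem_cells]
  simp only [tauDiagram, Finset.mem_union, Finset.mem_image, Finset.mem_range,
    Finset.mem_filter, YoungDiagram.mem_cells, Prod.mk.injEq, Prod.exists]
  constructor
  · rintro (⟨a, ha, rfl, rfl⟩ | ⟨a, b, ⟨hab, hb⟩, rfl, rfl⟩)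
    · exact Or.inl ⟨rfl, ha⟩
    · refine Or.inr ⟨a, rfl, ?_⟩
      simpa [Nat.sub_add_cancel hb] using hab
  · rintro (⟨rfl, h⟩ | ⟨r', rfl, h⟩)
    · exact Or.inl ⟨c, h, rfl, rfl⟩
    · exact Or.inr ⟨r', c + 1, ⟨h, by omega⟩, rfl, by omega⟩

theorem tauDiagram_mem (N : ℕ) (μ : YN N) : tauDiagram N μ ∈ YN N := by
  have h0 : μ.1.rowLen 0 + μ.1.colLen 0 - 1 < N := μ.2
  have hr : (tauDiagram N μ).rowLen 0 ≤ N - μ.1.colLen 0 - 1 := by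
    by_contra hlt
    have hm := (YoungDiagram.mem_iff_lt_rowLen (μ := tauDiagram N μ)).2 (not_le.1 hlt)
    rw [mem_tauDiagram] at hm
    rcases hm with ⟨-, h⟩ | ⟨r', h, -⟩ <;> omega
  have hc : (tauDiagram N μ).colLen 0 ≤ μ.1.colLen 0 + 1 := by
    by_contra hlt
    have hm := (YoungDiagram.mem_iff_lt_colLen (μ := tauDiagram N μ)).2 (not_le.1 hlt)
    rw [mem_tauDiagram] at hm
    rcases hm with ⟨h, -⟩ | ⟨r', h, h'⟩
    · omega
    · have h3 : (r', 0) ∈ μ.1 := μ.1.up_left_mem le_rfl (Nat.zero_le _) h'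
      rw [YoungDiagram.mem_iff_lt_colLen] at h3
      omega
  have hc' : (tauDiagram N μ).colLen 0 ≤ N := by
    by_contra hlt
    have hm := (YoungDiagram.mem_iff_lt_colLen (μ := tauDiagram N μ)).2 (not_le.1 hlt)
    rw [mem_tauDiagram] at hm
    rcases hm with ⟨h, -⟩ | ⟨r', h, h'⟩
    · omega
    · have h3 : (r', 0) ∈ μ.1 := μ.1.up_left_mem le_rfl (Nat.zero_le _) h'
      have h4 : (0, 0) ∈ μ.1 := μ.1.up_left_mem (Nat.zero_le _) le_rfl h3
      rw [YoungDiagram.mem_iff_lt_colLen] at h3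
      rw [YoungDiagram.mem_iff_lt_rowLen] at h4
      omega
  show (tauDiagram N μ).rowLen 0 + (tauDiagram N μ).colLen 0 - 1 < N
  omega

/-- The cyclic action `τ : 𝕐_N → 𝕐_N`,
`(μ₁, …, μ_m) ↦ (N - m - 1, μ₁ - 1, …, μ_m - 1)` with trailing zeros removed. -/
def tau (N : ℕ) (μ : YN N) : YN N := ⟨tauDiagram N μ, tauDiagram_mem N μ⟩

/-! ### The discrete Möbius strip and outer rims -/

/-- The distance `2 · min {|j - i|, N - |j - i|}` of the points with indices `i` and `j` on the
`N`-cycle; the formula is used for `0 ≤ i, j ≤ N`, where the index `N` stands for the index `0`. -/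
def cycleDist (N i j : ℕ) : ℤ := 2 * min |(j : ℤ) - i| (N - |(j : ℤ) - i|)

/-- The positions `(i, j)` with `0 ≤ i ≤ j ≤ N` of the triangular shape. -/
abbrev Position (N : ℕ) : Type := {p : ℕ × ℕ // p.1 ≤ p.2 ∧ p.2 ≤ N}

/-- The identification `(i, N) = (0, i)`. -/
inductive StripGlue (N : ℕ) : Position N → Position N → Prop
  | glue (i : ℕ) (hi : i ≤ N) :
      StripGlue N ⟨(i, N), hi, le_rfl⟩ ⟨(0, i), Nat.zero_le i, hi⟩

/-- The discrete Möbius strip `𝔛_N`; its elements are called sites. -/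
def MobiusStrip (N : ℕ) : Type := Quot (StripGlue N)

/-- The site given by a position in the triangular shape. -/
def site {N : ℕ} (p : Position N) : MobiusStrip N := Quot.mk _ p

/-- The distance `d(α_i, α_j)` on the `N`-cycle attached to the site `(i, j)`. -/
def siteDist (N : ℕ) : MobiusStrip N → ℤ :=
  Quot.lift (fun p : Position N => cycleDist N p.1.1 p.1.2) (by
    rintro _ _ ⟨i, hi⟩
    have h1 : |(N : ℤ) - i| = N - i := abs_of_nonneg (by omega)
    have h2 : |(i : ℤ) - (0 : ℕ)| = i := by simp
    simp only [cycleDist, h1, h2]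
    rw [min_comm]
    congr 2
    ring)

/-- The restricted Möbius strip `𝔛_N° = {(i, j) ∈ 𝔛_N | d(α_i, α_j) ≥ 2 (k - 1)}`,
`N = 2 k + 1`. -/
def restrictedStrip (k : ℕ) : Set (MobiusStrip (2 * k + 1)) :=
  {s | 2 * ((k : ℤ) - 1) ≤ siteDist (2 * k + 1) s}

/-- The positions on the outer rim of `μ`. In the triangular shape the box of `μ` in row `r` and
column `c` occupies the position `(c, N - r)`, so that the position `(i, j)` is a box of `μ`
when `(N - j, i) ∈ μ`. The outer rim runs along the outside of the diagram: its positions are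
not in `μ`, but the next position `(i - 1, j + 1)` on the diagonal towards the corner is in `μ`
or outside of the triangular shape. The rim is continued along the two lower sides of the
triangular shape as long as it meets no position that is identified with a box of `μ`: on the
side `i = 0` it consists of the `(0, j)` with `μ₁ ≤ j ≤ N - m`, on the side `j = N` of the
`(i, N)` with `μ₁ ≤ i ≤ N - m`, where `m` is the number of parts; these are the same sites. -/
def IsRimPosition (N : ℕ) (μ : YoungDiagram) (p : Position N) : Prop :=
  (N - p.1.2, p.1.1) ∉ μ ∧
  (p.1.1 = 0 ∨ p.1.2 = N ∨ (N - p.1.2 - 1, p.1.1 - 1) ∈ μ) ∧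
  (p.1.1 = 0 → μ.rowLen 0 ≤ p.1.2) ∧
  (p.1.2 = N → p.1.1 ≤ N - μ.colLen 0)

/-- The outer rim `𝓛_μ ⊆ 𝔛_N` of `μ ∈ 𝕐_N`. -/
def outerRim {N : ℕ} (μ : YN N) : Set (MobiusStrip N) :=
  site '' {p | IsRimPosition N μ.1 p}

/-- `𝕐_N°` for `N = 2 k + 1`: the partitions in `𝕐_N` with outer rim contained in `𝔛_N°`. -/
def YNcirc (k : ℕ) : Set (YN (2 * k + 1)) := {μ | outerRim μ ⊆ restrictedStrip k}

/-- The inner corners of a Young diagram, the boxes without a right and without a lower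
neighbour. -/
def innerCorners (μ : YoungDiagram) : Finset (ℕ × ℕ) :=
  μ.cells.filter fun b => (b.1 + 1, b.2) ∉ μ ∧ (b.1, b.2 + 1) ∉ μ

/-- `μ'` is obtained from `μ` by removing `v` inner corners of `μ`. -/
def IsCornerRemoval (v : ℕ) (μ' μ : YoungDiagram) : Prop :=
  ∃ V ⊆ innerCorners μ, V.card = v ∧ μ'.cells = μ.cells \ V

/-! ### Injective hulls as polyhedral complexes -/

/-- The polyhedron `Δ(X)`. -/
def hullPolyhedron (X : Type*) [MetricSpace X] : Set (X → ℝ) :=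
  {g | ∀ x y, dist x y ≤ g x + g y}

/-- The injective hull `E(X)` of a finite metric space. -/
def injectiveHull (X : Type*) [MetricSpace X] : Set (X → ℝ) :=
  {g | g ∈ hullPolyhedron X ∧ ∀ x, ∃ y, g x + g y = dist x y}

/-- The `v`-faces of the polyhedral complex `E(X)`: the nonempty faces of dimension `v` of the
polyhedron `Δ(X)` that are contained in `E(X)`. -/
def IsHullFace (X : Type*) [MetricSpace X] (v : ℕ) (F : Set (X → ℝ)) : Prop :=
  F.Nonempty ∧ IsExposed ℝ (hullPolyhedron X) F ∧ F ⊆ injectiveHull X ∧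
    Module.finrank ℝ (vectorSpan ℝ F) = v

/-- The vertices of the polyhedral complex `E(X)`. -/
def hullVertices (X : Type*) [MetricSpace X] : Set (X → ℝ) := {g | IsHullFace X 0 {g}}

/-- The function `g_μ` on the `N`-cycle, `N = 2 k + 1`, given by
`g_μ(α_j) = |τ^j(μ)| - k (k - 1) / 2`. -/
noncomputable def gFun {k : ℕ} {C : Type*} (α : Fin (2 * k + 1) ≃ C) (μ : YN (2 * k + 1)) :
    C → ℝ :=
  fun x => ((((tau (2 * k + 1))^[(α.symm x : ℕ)] μ).1.card : ℕ) : ℝ) - (k : ℝ) * ((k : ℝ) - 1) / 2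

/-- `g` solves the linear system `g(α_i) + g(α_j) = d(α_i, α_j)`, one equation for each site
`(i, j)` on the outer rim of `μ`, where `α_N = α_0`. -/
def SolvesRimSystem {N : ℕ} [NeZero N] {C : Type*} [MetricSpace C] (α : Fin N ≃ C) (μ : YN N)
    (g : C → ℝ) : Prop :=
  ∀ p : Position N, site p ∈ outerRim μ →
    g (α (Fin.ofNat N p.1.1)) + g (α (Fin.ofNat N p.1.2)) =
      dist (α (Fin.ofNat N p.1.1)) (α (Fin.ofNat N p.1.2))

/-!
Enumerate the points of the `N`-cycle, `N = 2 k + 1`, as `P t = α_{k t}`, `t ∈ ZMod N`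
(`antipodalEnum`). Then `P t` and `P (t + 1)` are antipodal, at distance `2 k`, and `P t` and
`P (t + 2)` are neighbours. Since `N` is odd, a function `g` on the cycle is determined by its
slacks `a_t = g (P t) + g (P (t + 1)) - 2 k`, which can be prescribed arbitrarily (`slack`). In
these coordinates `E(C_N)` is the set of all `a ∈ [0, 2]^N` with `a_t = 0` or `a_{t + 1} = 0` for
all `t` (`mem_injectiveHull_iff`): in the hull every tight pair extends along a geodesic to an
antipodal tight pair, and the Lipschitz condition for neighbours bounds the slacks by `2`. So
`E(C_N)` is the cubical complex of the independent sets of an `N`-cycle. Its faces are the cubes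
given by sets `S ⊆ B` with `B` independent, where `a = 2` on `S` and `a = 0` outside of `B`
(`isHullFace_iff`), and its vertices are the functions with `a = 2` on an independent set and
`a = 0` elsewhere.

On the side of the partitions, `μ ∈ 𝕐_N°` means that `μ` contains all boxes with `r + c ≤ k - 2`
and only boxes with `r + c ≤ k` (`mem_YNcirc_iff`). The `N` boxes in between form a zigzag.
Number them from `0` to `2 k`, and let `U` consist of the even numbers of boxes in `μ` and the
odd numbers of boxes not in `μ` (`deviationSet`). The shape of a Young diagram and the bound on
the hook lengths say exactly that `U` is independent in the cyclic order, so `𝕐_N°` is in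
bijection with the independent sets (`isIndep_deviationSet`, `diagramOfIndep`). The action `τ`
rotates `U` by two steps (`mem_deviationSet_tau`), and `|μ|` is an alternating sum over `U` up to
a constant (`InStrip.card_eq`); inverting the slack coordinates is the same alternating sum, so
that `g_μ` has the slack `2` on `U` and `0` elsewhere (`gFun_eq_slack_symm`). The outer rim of
`μ` consists of the antipodal pairs `t ∉ U` and of the pairs `P (t - 1)`, `P (t + 2)` for `t ∈ U`
(`sitePair_image_outerRim`), whose equations are equivalent to these slacks. Finally, the removal
of inner corners changes `U` on a set `B \ S` with `S ⊆ B` as above, and all such pairs `S ⊆ B`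
occur (`deviationSet_image_Icc`, `exists_isCornerRemoval`).
-/

/-! ### Slack coordinates on an odd cycle -/

theorem two_mul_natCast_zmod (k : ℕ) : (2 : ZMod (2 * k + 1)) * (k : ZMod (2 * k + 1)) = -1 := by
  have h := ZMod.natCast_self (2 * k + 1)
  push_cast at h
  linear_combination h

/-- `P` enumerates the points of an odd cycle so that consecutive points are antipodal (at distance
`2 k`): a step of `1` moves to an antipodal point and a step of `2` to a neighbour. -/
def IsAntipodalEnum {k : ℕ} {C : Type*} [MetricSpace C] (P : ZMod (2 * k + 1) ≃ C) : Prop :=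
  ∀ (s : ZMod (2 * k + 1)) (m : ℕ), m ≤ k → dist (P s) (P (s + 1 + 2 * m)) = 2 * ((k : ℝ) - m)

/-- The enumeration `t ↦ α_{k t}` of the points of the `N`-cycle, `N = 2 k + 1`. -/
def antipodalEnum {k : ℕ} {C : Type*} (α : Fin (2 * k + 1) ≃ C) : ZMod (2 * k + 1) ≃ C where
  toFun t := α ⟨((k : ZMod (2 * k + 1)) * t).val, ZMod.val_lt _⟩
  invFun x := -2 * (((α.symm x : Fin (2 * k + 1)) : ℕ) : ZMod (2 * k + 1))
  left_inv t := by
    simp only [Equiv.symm_apply_apply, ZMod.natCast_zmod_val]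
    linear_combination (-t) * two_mul_natCast_zmod k
  right_inv x := by
    have h : (k : ZMod (2 * k + 1)) * (-2 * (((α.symm x : Fin (2 * k + 1)) : ℕ) :
        ZMod (2 * k + 1))) = (((α.symm x : Fin (2 * k + 1)) : ℕ) : ZMod (2 * k + 1)) := by
      linear_combination (-(((α.symm x : Fin (2 * k + 1)) : ℕ) : ZMod (2 * k + 1))) *
        two_mul_natCast_zmod k
    rw [← Equiv.eq_symm_apply]
    ext
    simp only [h, ZMod.val_natCast]
    exact Nat.mod_eq_of_lt (α.symm x).2

theorem antipodalEnum_apply {k : ℕ} {C : Type*} (α : Fin (2 * k + 1) ≃ C)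
    (t : ZMod (2 * k + 1)) :
    antipodalEnum α t = α ⟨((k : ZMod (2 * k + 1)) * t).val, ZMod.val_lt _⟩ := rfl

theorem apply_ofNat_eq_antipodalEnum {k : ℕ} {C : Type*} (α : Fin (2 * k + 1) ≃ C) (i : ℕ) :
    α (Fin.ofNat (2 * k + 1) i) = antipodalEnum α (-2 * (i : ZMod (2 * k + 1))) := by
  rw [antipodalEnum_apply]
  congr 1
  have h : (k : ZMod (2 * k + 1)) * (-2 * (i : ZMod (2 * k + 1))) = i := by
    linear_combination (-(i : ZMod (2 * k + 1))) * two_mul_natCast_zmod k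
  ext
  simp only [h, ZMod.val_natCast]
  rfl

theorem isAntipodalEnum_antipodalEnum {k : ℕ} {C : Type*} [MetricSpace C]
    (α : Fin (2 * k + 1) ≃ C)
    (hα : ∀ i j : Fin (2 * k + 1),
      dist (α i) (α j) = (cycleDist (2 * k + 1) (i : ℕ) (j : ℕ) : ℝ)) :
    IsAntipodalEnum (antipodalEnum α) := by
  intro s m hm
  rw [antipodalEnum_apply, antipodalEnum_apply, hα]
  obtain ⟨l, rfl⟩ : ∃ l, k = m + l := ⟨k - m, by omega⟩
  set x : ZMod (2 * (m + l) + 1) := ((m + l : ℕ) : ZMod (2 * (m + l) + 1)) * s with hx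
  have e : ((m + l : ℕ) : ZMod (2 * (m + l) + 1)) * (s + 1 + 2 * m) = x + (l : ℕ) := by
    have h := two_mul_natCast_zmod (m + l)
    push_cast at h hx ⊢
    linear_combination (m : ZMod (2 * (m + l) + 1)) * h - hx
  have hl : ((l : ℕ) : ZMod (2 * (m + l) + 1)).val = l :=
    ZMod.val_natCast_of_lt (by omega)
  have hxlt := ZMod.val_lt x
  rw [e]
  have key : cycleDist (2 * (m + l) + 1) x.val (x + (l : ℕ)).val = 2 * l := by
    unfold cycleDist
    by_cases hlt : x.val + l < 2 * (m + l) + 1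
    · have h1 : (x + (l : ℕ)).val = x.val + l := by
        rw [ZMod.val_add_of_lt (by rw [hl]; exact hlt), hl]
      rw [h1]
      push_cast
      rw [add_sub_cancel_left, abs_of_nonneg (by positivity), min_eq_left (by omega)]
    · have h1 : (x + (l : ℕ)).val = x.val + l - (2 * (m + l) + 1) := by
        rw [ZMod.val_add_of_le (by rw [hl]; omega), hl]
      rw [h1, Nat.cast_sub (by omega)]
      push_cast
      rw [abs_of_nonpos (by omega), min_eq_right (by omega)]
      ring
  simp only [key]
  push_cast
  ring

section Slack

variable {k : ℕ} {C : Type*}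

/-- The linear bijection that sends a function `g` to its sums over the consecutive pairs of an
enumeration of odd length. Its inverse is half of the alternating sum around the cycle; the sum
telescopes, and because the length is odd the two ends add up instead of cancelling. -/
noncomputable def pairSum (P : ZMod (2 * k + 1) ≃ C) : (C → ℝ) ≃ₗ[ℝ] (ZMod (2 * k + 1) → ℝ) where
  toFun g t := g (P t) + g (P (t + 1))
  map_add' g h := by ext t; simp only [Pi.add_apply]; ring
  map_smul' c g := by ext t; simp only [Pi.smul_apply, smul_eq_mul, RingHom.id_apply]; ring
  invFun a x := (∑ s ∈ Finset.range (2 * k + 1), (-1) ^ s * a (P.symm x + (s : ℕ))) / 2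
  left_inv g := by
    ext x
    have h : ∀ n : ℕ, ∑ s ∈ Finset.range n, (-1 : ℝ) ^ s *
        (g (P (P.symm x + (s : ℕ))) + g (P (P.symm x + (s : ℕ) + 1))) =
        g x - (-1) ^ n * g (P (P.symm x + (n : ℕ))) := by
      intro n
      induction n with
      | zero => simp
      | succ n ih => rw [Finset.sum_range_succ, ih]; push_cast; rw [← add_assoc]; ring
    simp only
    rw [h (2 * k + 1), ZMod.natCast_self, add_zero, Equiv.apply_symm_apply]
    have h1 : (-1 : ℝ) ^ (2 * k + 1) = -1 := Odd.neg_one_pow ⟨k, rfl⟩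
    rw [h1]
    ring
  right_inv a := by
    ext t
    have h : ∀ n : ℕ, ∑ s ∈ Finset.range n, (-1 : ℝ) ^ s * a (t + (s : ℕ)) +
        ∑ s ∈ Finset.range n, (-1 : ℝ) ^ s * a (t + 1 + (s : ℕ)) =
        a t - (-1) ^ n * a (t + (n : ℕ)) := by
      intro n
      induction n with
      | zero => simp
      | succ n ih =>
        rw [Finset.sum_range_succ, Finset.sum_range_succ]
        have e : t + 1 + (n : ZMod (2 * k + 1)) = t + ((n + 1 : ℕ) : ZMod (2 * k + 1)) := by
          push_cast; ring
        rw [e]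
        linear_combination ih
    have h2 := h (2 * k + 1)
    have h1 : (-1 : ℝ) ^ (2 * k + 1) = -1 := Odd.neg_one_pow ⟨k, rfl⟩
    rw [ZMod.natCast_self, add_zero, h1] at h2
    simp only [Equiv.symm_apply_apply]
    linear_combination h2 / 2

/-- The slack coordinates of `g`: the differences `g x + g y - d(x, y)` for the antipodal pairs
`x = P t`, `y = P (t + 1)`. They determine `g`. -/
noncomputable def slack (P : ZMod (2 * k + 1) ≃ C) :
    (C → ℝ) ≃ᵃ[ℝ] (ZMod (2 * k + 1) → ℝ) :=
  (pairSum P).toAffineEquiv.trans (AffineEquiv.constVAdd ℝ _ (fun _ => -(2 * (k : ℝ))))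

theorem slack_apply (P : ZMod (2 * k + 1) ≃ C) (g : C → ℝ) (t : ZMod (2 * k + 1)) :
    slack P g t = g (P t) + g (P (t + 1)) - 2 * k := by
  have : slack P g t = -(2 * (k : ℝ)) + (g (P t) + g (P (t + 1))) := rfl
  rw [this]
  ring

theorem slack_symm_apply (P : ZMod (2 * k + 1) ≃ C) (a : ZMod (2 * k + 1) → ℝ)
    (t : ZMod (2 * k + 1)) :
    (slack P).symm a (P t) =
      k + (∑ s ∈ Finset.range (2 * k + 1), (-1) ^ s * a (t + (s : ℕ))) / 2 := by
  have h : (slack P).symm a (P t) = (∑ s ∈ Finset.range (2 * k + 1), (-1) ^ s *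
      (- -(2 * (k : ℝ)) + a (P.symm (P t) + (s : ℕ)))) / 2 := rfl
  have h1 : ∀ n : ℕ, ∑ s ∈ Finset.range (2 * n + 1), (-1 : ℝ) ^ s = 1 := by
    intro n
    induction n with
    | zero => simp
    | succ n ih =>
      rw [show 2 * (n + 1) + 1 = 2 * n + 1 + 1 + 1 by ring, Finset.sum_range_succ,
        Finset.sum_range_succ, ih, pow_succ]
      ring
  rw [h, Equiv.symm_apply_apply]
  simp only [mul_add, Finset.sum_add_distrib, ← Finset.sum_mul, h1]
  ring

theorem exists_eq_add_one_add_two_mul (s t : ZMod (2 * k + 1)) :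
    ∃ m : ℕ, m ≤ k ∧ (t = s + 1 + 2 * m ∨ s = t + 1 + 2 * m) := by
  have hk := two_mul_natCast_zmod k
  set d : ZMod (2 * k + 1) := k * (t - s) with hd
  have hlt := ZMod.val_lt d
  have hv : ((d.val : ℕ) : ZMod (2 * k + 1)) = d := ZMod.natCast_zmod_val d
  rcases le_or_gt d.val k with h | h
  · refine ⟨k - d.val, Nat.sub_le _ _, Or.inl ?_⟩
    rw [Nat.cast_sub h, hv]
    linear_combination (-1 + (t - s)) * hk - 2 * hd
  · refine ⟨d.val - (k + 1), by omega, Or.inr ?_⟩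
    rw [Nat.cast_sub (by omega), hv]
    push_cast
    linear_combination (-2) * hd + (1 - (t - s)) * hk

/-- The slack of the pair `P (t - 1)`, `P (t + 2)` of distance `2 (k - 1)`, in terms of the slacks
of the antipodal pairs. -/
theorem slack_second (P : ZMod (2 * k + 1) ≃ C) (g : C → ℝ) (t : ZMod (2 * k + 1)) :
    g (P (t - 1)) + g (P (t + 2)) - 2 * ((k : ℝ) - 1) =
      2 + slack P g (t - 1) + slack P g (t + 1) - slack P g t := by
  simp only [slack_apply]
  rw [show t - 1 + 1 = t by ring, show t + 1 + 1 = t + 2 by ring]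
  ring

variable [MetricSpace C] {P : ZMod (2 * k + 1) ≃ C}

theorem IsAntipodalEnum.dist_succ (hP : IsAntipodalEnum P) (t : ZMod (2 * k + 1)) :
    dist (P t) (P (t + 1)) = 2 * k := by
  simpa using hP t 0 (Nat.zero_le _)

theorem IsAntipodalEnum.dist_add_two_mul (hP : IsAntipodalEnum P) (t : ZMod (2 * k + 1)) {m : ℕ}
    (hm : m ≤ k) : dist (P t) (P (t + 2 * m)) = 2 * m := by
  have h := hP (t + 2 * m) (k - m) (Nat.sub_le _ _)
  have e : t + 2 * m + 1 + 2 * ((k - m : ℕ) : ZMod (2 * k + 1)) = t := by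
    rw [Nat.cast_sub hm]
    linear_combination two_mul_natCast_zmod k
  rw [e, dist_comm, Nat.cast_sub hm] at h
  rw [h]
  ring

theorem IsAntipodalEnum.dist_second (hP : IsAntipodalEnum P) (hk : 1 ≤ k)
    (t : ZMod (2 * k + 1)) : dist (P (t - 1)) (P (t + 2)) = 2 * ((k : ℝ) - 1) := by
  have h := hP (t - 1) 1 hk
  rw [show t - 1 + 1 + 2 * ((1 : ℕ) : ZMod (2 * k + 1)) = t + 2 by push_cast; ring] at h
  simpa using h

theorem le_dist_add_of_mem_injectiveHull {g : C → ℝ} (hg : g ∈ injectiveHull C) (x y : C) :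
    g x ≤ dist x y + g y := by
  obtain ⟨z, hz⟩ := hg.2 x
  have h1 := hg.1 y z
  have h2 := dist_triangle x y z
  linarith

/-- The injective hull of an odd cycle in slack coordinates. Tight pairs extend along geodesics to
antipodal tight pairs, and a step of length `2` changes `g` by the difference of two consecutive
slacks; this makes the conditions necessary. Conversely they make `g` Lipschitz, and then the
antipodal inequalities imply all others. -/
theorem mem_injectiveHull_iff (hP : IsAntipodalEnum P) (g : C → ℝ) :
    g ∈ injectiveHull C ↔
      ∀ t, 0 ≤ slack P g t ∧ slack P g t ≤ 2 ∧ (slack P g t = 0 ∨ slack P g (t + 1) = 0) := by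
  constructor
  · intro hg
    have h0 : ∀ t, 0 ≤ slack P g t := by
      intro t
      have := hg.1 (P t) (P (t + 1))
      rw [hP.dist_succ] at this
      rw [slack_apply]
      linarith
    have hz : ∀ t, slack P g t = 0 ∨ slack P g (t + 1) = 0 := by
      intro t
      obtain ⟨y, hy⟩ := hg.2 (P (t + 1))
      obtain ⟨u, rfl⟩ := P.surjective y
      obtain ⟨m, hm, h | h⟩ := exists_eq_add_one_add_two_mul (t + 1) u
      · right
        apply le_antisymm _ (h0 _)
        have h1 := hP (t + 1) m hm
        rw [← h, ← hy] at h1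
        have h2 := le_dist_add_of_mem_injectiveHull hg (P (t + 1 + 1)) (P u)
        have h3 := hP.dist_add_two_mul (t + 1 + 1) hm
        rw [← h] at h3
        rw [slack_apply]
        linarith
      · left
        apply le_antisymm _ (h0 _)
        have h1 := hP u m hm
        rw [← h, dist_comm, ← hy] at h1
        have h' : t = u + 2 * m := by linear_combination h
        have h2 := le_dist_add_of_mem_injectiveHull hg (P t) (P u)
        have h3 := hP.dist_add_two_mul u hm
        rw [← h', dist_comm] at h3
        rw [slack_apply]
        linarith
    intro t
    refine ⟨h0 t, ?_, hz t⟩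
    rcases hz t with h | h
    · rw [h]; norm_num
    · have h1 := le_dist_add_of_mem_injectiveHull hg (P t) (P (t + 1 + 1))
      have h2 : dist (P t) (P (t + 1 + 1)) ≤ 2 := by
        rcases Nat.eq_zero_or_pos k with rfl | hk
        · rw [show t + 1 + 1 = t from Subsingleton.elim (α := Fin 1) _ _, dist_self]
          norm_num
        · have h3 := hP.dist_add_two_mul t (m := 1) hk
          rw [show t + 2 * ((1 : ℕ) : ZMod (2 * k + 1)) = t + 1 + 1 by push_cast; ring] at h3
          rw [h3]
          norm_num
      rw [slack_apply] at h ⊢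
      linarith
  · intro h
    have lip : ∀ (m : ℕ) (s : ZMod (2 * k + 1)), |g (P s) - g (P (s + 2 * m))| ≤ 2 * m := by
      intro m
      induction m with
      | zero => intro s; simp
      | succ m ih =>
        intro s
        have h1 := ih s
        have h2 := h (s + 2 * m)
        have h3 := h (s + 2 * m + 1)
        rw [slack_apply] at h2 h3
        have e : s + 2 * ((m + 1 : ℕ) : ZMod (2 * k + 1)) = s + 2 * m + 1 + 1 := by
          push_cast; ring
        rw [e]
        push_cast
        rw [abs_le] at h1 ⊢
        constructor <;> linarith [h1.1, h1.2, h2.1, h2.2.1, h3.1, h3.2.1]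
    have hle : ∀ (s : ZMod (2 * k + 1)) (m : ℕ), m ≤ k →
        dist (P s) (P (s + 1 + 2 * m)) ≤ g (P s) + g (P (s + 1 + 2 * m)) := by
      intro s m hm
      have h1 := (h s).1
      rw [slack_apply] at h1
      have h2 := (abs_le.1 (lip m (s + 1))).2
      rw [hP s m hm]
      linarith
    constructor
    · intro x y
      obtain ⟨s, rfl⟩ := P.surjective x
      obtain ⟨t, rfl⟩ := P.surjective y
      obtain ⟨m, hm, rfl | rfl⟩ := exists_eq_add_one_add_two_mul s t
      · exact hle s m hm
      · rw [dist_comm, add_comm (g _)]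
        exact hle t m hm
    · intro x
      obtain ⟨s, rfl⟩ := P.surjective x
      have h1 := h (s - 1)
      rw [sub_add_cancel] at h1
      rcases h1.2.2 with h2 | h2
      · refine ⟨P (s - 1), ?_⟩
        rw [slack_apply, sub_add_cancel] at h2
        have h3 := hP.dist_succ (s - 1)
        rw [sub_add_cancel] at h3
        rw [dist_comm, h3]
        linarith
      · refine ⟨P (s + 1), ?_⟩
        rw [slack_apply] at h2
        rw [hP.dist_succ]
        linarith

end Slack

/-! ### The faces of the injective hull of an odd cycle -/

/-- Sets of vertices of the `N`-cycle `ZMod N`, `N = 2 k + 1`, without two consecutive elements.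
For `N = 1` only the empty set qualifies, because `t + 1 = t`. -/
def IsIndep {k : ℕ} (B : Finset (ZMod (2 * k + 1))) : Prop := ∀ t ∈ B, t + 1 ∉ B

/-- The point of the cube `[0, 2]^N` with value `2` on `W` and `0` elsewhere. -/
def cornerVec {k : ℕ} (W : Finset (ZMod (2 * k + 1))) : ZMod (2 * k + 1) → ℝ :=
  fun t => if t ∈ W then 2 else 0

/-- The cube of all functions whose slack coordinates are `2` on `S`, lie in `[0, 2]` on `B \ S`
and vanish outside of `B`. -/
def cubeFace {k : ℕ} {C : Type*} (P : ZMod (2 * k + 1) ≃ C) (S B : Finset (ZMod (2 * k + 1))) :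
    Set (C → ℝ) :=
  {g | ∀ t, 0 ≤ slack P g t ∧ slack P g t ≤ 2 ∧ (t ∉ B → slack P g t = 0) ∧
    (t ∈ S → slack P g t = 2)}

theorem IsIndep.pos_of_mem {k : ℕ} {B : Finset (ZMod (2 * k + 1))} (hB : IsIndep B)
    {t : ZMod (2 * k + 1)} (ht : t ∈ B) : 1 ≤ k := by
  rcases Nat.eq_zero_or_pos k with rfl | hk
  · exact absurd ht (by
      rw [← show t + 1 = t from Subsingleton.elim (α := Fin 1) _ _]
      exact hB t ht)
  · exact hk

theorem cornerVec_injective {k : ℕ} : Function.Injective (cornerVec (k := k)) := by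
  intro W W' h
  ext t
  have := congrFun h t
  unfold cornerVec at this
  by_cases h1 : t ∈ W <;> by_cases h2 : t ∈ W' <;> simp_all

section CubeFaces

variable {k : ℕ} {C : Type*} {P : ZMod (2 * k + 1) ≃ C} {S B W : Finset (ZMod (2 * k + 1))}

theorem slack_symm_cornerVec_mem_cubeFace (hS : S ⊆ W) (hB : W ⊆ B) :
    (slack P).symm (cornerVec W) ∈ cubeFace P S B := by
  intro t
  rw [AffineEquiv.apply_symm_apply]
  unfold cornerVec
  split_ifs with h
  · exact ⟨by norm_num, le_rfl, fun h' => (h' (hB h)).elim, fun _ => rfl⟩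
  · exact ⟨le_rfl, by norm_num, fun _ => rfl, fun h' => (h (hS h')).elim⟩

theorem cubeFace_self (B : Finset (ZMod (2 * k + 1))) :
    cubeFace P B B = {(slack P).symm (cornerVec B)} := by
  apply Set.Subset.antisymm
  · intro g hg
    rw [Set.mem_singleton_iff, AffineEquiv.eq_symm_apply]
    ext t
    unfold cornerVec
    split_ifs with h
    · exact (hg t).2.2.2 h
    · exact (hg t).2.2.1 h
  · rw [Set.singleton_subset_iff]
    exact slack_symm_cornerVec_mem_cubeFace subset_rfl subset_rfl

/-- The change of a function under a change of its slack coordinates. -/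
theorem slack_symm_sub (P : ZMod (2 * k + 1) ≃ C) (a a' : ZMod (2 * k + 1) → ℝ) :
    (slack P).symm a - (slack P).symm a' =
      ∑ t, (a t - a' t) • (pairSum P).symm (Pi.single t 1) := by
  have h : (slack P).symm a - (slack P).symm a' = (pairSum P).symm (a - a') :=
    ((slack P).symm.toAffineMap.linearMap_vsub a a').symm
  rw [h]
  conv_lhs => rw [← Finset.univ_sum_single (a - a')]
  rw [map_sum]
  refine Finset.sum_congr rfl fun t _ => ?_
  rw [← map_smul, ← Pi.single_smul]
  simp

theorem slack_symm_image_pi (P : ZMod (2 * k + 1) ≃ C) (hSB : S ⊆ B) :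
    cubeFace P S B = (slack P).symm '' Set.univ.pi fun t =>
      convexHull ℝ (if t ∈ S then {(2 : ℝ)} else if t ∈ B then {0, 2} else {0}) := by
  ext g
  rw [AffineEquiv.image_symm, Set.mem_preimage, Set.mem_univ_pi]
  refine forall_congr' fun t => ?_
  by_cases h1 : t ∈ S
  · have h2 := hSB h1
    simp only [h1, h2, not_true_eq_false, false_implies, true_and, forall_const, if_true,
      convexHull_singleton, Set.mem_singleton_iff]
    exact ⟨fun h => h.2.2, fun h => by rw [h]; norm_num⟩
  · by_cases h2 : t ∈ B
    · simp only [h1, h2, not_true_eq_false, false_implies, and_true, if_true, if_false,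
        convexHull_pair, segment_eq_Icc (zero_le_two (α := ℝ)), Set.mem_Icc]
    · simp only [h1, h2, not_false_eq_true, false_implies, and_true, if_false, forall_const,
        convexHull_singleton, Set.mem_singleton_iff]
      exact ⟨fun h => h.2.2, fun h => by rw [h]; norm_num⟩

theorem cubeFace_eq_convexHull (P : ZMod (2 * k + 1) ≃ C) (hSB : S ⊆ B) :
    cubeFace P S B =
      convexHull ℝ ((fun W => (slack P).symm (cornerVec W)) '' Set.Icc S B) := by
  have h : (Set.univ.pi fun t => (if t ∈ S then {(2 : ℝ)} else if t ∈ B then {0, 2} else {0})) =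
      cornerVec '' Set.Icc S B := by
    ext a
    simp only [Set.mem_univ_pi, Set.mem_image, Set.mem_Icc]
    constructor
    · intro ha
      refine ⟨Finset.univ.filter fun t => a t = 2, ⟨?_, ?_⟩, ?_⟩
      · intro t ht
        have := ha t
        simpa [ht] using this
      · intro t ht
        have ht : a t = 2 := by simpa using ht
        by_contra hB
        have := ha t
        have hS : t ∉ S := fun h => hB (hSB h)
        simp [hB, hS, ht] at this
      · ext t
        have := ha t
        unfold cornerVec
        by_cases h2 : a t = 2
        · simp [h2]
        · by_cases h3 : t ∈ S
          · simp [h3, h2] at this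
          · by_cases h4 : t ∈ B
            · simp [h3, h4, h2] at this
              simp [this]
            · simp [h3, h4] at this
              simp [this]
    · rintro ⟨W, ⟨hS, hB⟩, rfl⟩ t
      unfold cornerVec
      by_cases h1 : t ∈ S
      · simp [h1, hS h1]
      · by_cases h2 : t ∈ B
        · by_cases h3 : t ∈ W <;> simp [h1, h2, h3]
        · have h3 : t ∉ W := fun h => h2 (hB h)
          simp [h1, h2, h3]
  rw [slack_symm_image_pi P hSB, ← convexHull_pi, h,
    ← Set.image_image (slack P).symm cornerVec]
  exact (slack P).symm.toAffineMap.image_convexHull _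

theorem finrank_vectorSpan_cubeFace (P : ZMod (2 * k + 1) ≃ C) (hSB : S ⊆ B) :
    Module.finrank ℝ (vectorSpan ℝ (cubeFace P S B)) = (B \ S).card := by
  set w : ZMod (2 * k + 1) → C → ℝ := fun t => (pairSum P).symm (Pi.single t 1) with hw
  have hspan : vectorSpan ℝ (cubeFace P S B) =
      Submodule.span ℝ (Set.range fun t : (B \ S : Finset (ZMod (2 * k + 1))) => w t) := by
    apply le_antisymm
    · rw [vectorSpan_def, Submodule.span_le]
      rintro _ ⟨g, hg, g', hg', rfl⟩
      have h := slack_symm_sub P (slack P g) (slack P g')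
      rw [AffineEquiv.symm_apply_apply, AffineEquiv.symm_apply_apply] at h
      simp only [vsub_eq_sub, h]
      refine Submodule.sum_mem _ fun t _ => ?_
      by_cases ht : t ∈ B \ S
      · exact Submodule.smul_mem _ _ (Submodule.subset_span ⟨⟨t, ht⟩, rfl⟩)
      · have h0 : slack P g t - slack P g' t = 0 := by
          by_cases hB : t ∈ B
          · have hS : t ∈ S := by
              by_contra hS
              exact ht (Finset.mem_sdiff.2 ⟨hB, hS⟩)
            rw [(hg t).2.2.2 hS, (hg' t).2.2.2 hS, sub_self]
          · rw [(hg t).2.2.1 hB, (hg' t).2.2.1 hB, sub_self]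
        rw [h0, zero_smul]
        exact Submodule.zero_mem _
    · rw [Submodule.span_le]
      rintro _ ⟨⟨t, ht⟩, rfl⟩
      rw [Finset.mem_sdiff] at ht
      have h := slack_symm_sub P (cornerVec (insert t S)) (cornerVec S)
      rw [Finset.sum_eq_single t] at h
      · have h1 : cornerVec (insert t S) t - cornerVec S t = 2 := by simp [cornerVec, ht.2]
        rw [h1] at h
        have h2 := vsub_mem_vectorSpan ℝ
          (slack_symm_cornerVec_mem_cubeFace (P := P) (S := S) (B := B) (Finset.subset_insert t S)
            (Finset.insert_subset ht.1 hSB))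
          (slack_symm_cornerVec_mem_cubeFace (P := P) (subset_refl S) hSB)
        rw [vsub_eq_sub, h] at h2
        have h3 := Submodule.smul_mem _ (1 / 2 : ℝ) h2
        rwa [smul_smul, show (1 / 2 : ℝ) * 2 = 1 by norm_num, one_smul] at h3
      · intro u _ hu
        have : cornerVec (insert t S) u = cornerVec S u := by simp [cornerVec, hu]
        rw [this, sub_self, zero_smul]
      · simp
  have hli : LinearIndependent ℝ
      (fun t : (B \ S : Finset (ZMod (2 * k + 1))) => w t) := by
    have h1 := (Pi.basisFun ℝ (ZMod (2 * k + 1))).linearIndependent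
    have h2 := h1.map' (pairSum P).symm.toLinearMap (LinearEquiv.ker _)
    have h3 := h2.comp (fun t : (B \ S : Finset (ZMod (2 * k + 1))) => (t : ZMod (2 * k + 1)))
      Subtype.val_injective
    have h4 : ((pairSum P).symm.toLinearMap ∘ Pi.basisFun ℝ (ZMod (2 * k + 1))) = w := by
      ext t x
      simp [hw]
    rw [h4] at h3
    exact h3
  rw [hspan, finrank_span_eq_card hli, Fintype.card_coe]

variable [MetricSpace C]

theorem cubeFace_subset_injectiveHull (hP : IsAntipodalEnum P) (hB : IsIndep B) :
    cubeFace P S B ⊆ injectiveHull C := by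
  intro g hg
  rw [mem_injectiveHull_iff hP]
  refine fun t => ⟨(hg t).1, (hg t).2.1, ?_⟩
  by_cases h : t ∈ B
  · exact Or.inr ((hg _).2.2.1 (hB t h))
  · exact Or.inl ((hg t).2.2.1 h)

/-- The inequalities of `Δ` that are tight on `cubeFace P S B` are those of the antipodal pairs
with index outside of `B` and those of the pairs `P (t - 1)`, `P (t + 2)` with `t ∈ S`. Minus the
sum of the corresponding sums `g x + g y` is a linear functional that exposes the face. -/
theorem isExposed_cubeFace (hP : IsAntipodalEnum P) (hSB : S ⊆ B) (hB : IsIndep B) :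
    IsExposed ℝ (hullPolyhedron C) (cubeFace P S B) := by
  intro _
  set l : StrongDual ℝ (C → ℝ) :=
    -(∑ t ∈ Bᶜ, (ContinuousLinearMap.proj (R := ℝ) (φ := fun _ : C => ℝ) (P t) +
        ContinuousLinearMap.proj (P (t + 1))) +
      ∑ t ∈ S, (ContinuousLinearMap.proj (R := ℝ) (φ := fun _ : C => ℝ) (P (t - 1)) +
        ContinuousLinearMap.proj (P (t + 2)))) with hl
  set φ : (C → ℝ) → ℝ := fun g => ∑ t ∈ Bᶜ, slack P g t +
    ∑ t ∈ S, (g (P (t - 1)) + g (P (t + 2)) - 2 * ((k : ℝ) - 1)) with hφ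
  have hlφ : ∀ g g', l g ≤ l g' ↔ φ g' ≤ φ g := by
    intro g g'
    simp only [hl, hφ, slack_apply, Finset.sum_add_distrib, Finset.sum_sub_distrib,
      neg_apply, add_apply, sum_apply,
      ContinuousLinearMap.proj_apply]
    constructor <;> intro h <;> linarith
  have h1 : ∀ g ∈ hullPolyhedron C, ∀ t ∈ Bᶜ, 0 ≤ slack P g t := by
    intro g hg t _
    rw [slack_apply, ← hP.dist_succ t]
    linarith [hg (P t) (P (t + 1))]
  have h2 : ∀ g ∈ hullPolyhedron C, ∀ t ∈ B,
      0 ≤ g (P (t - 1)) + g (P (t + 2)) - 2 * ((k : ℝ) - 1) := by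
    intro g hg t ht
    rw [← hP.dist_second (hB.pos_of_mem ht)]
    linarith [hg (P (t - 1)) (P (t + 2))]
  have hpos : ∀ g ∈ hullPolyhedron C, 0 ≤ φ g := fun g hg =>
    add_nonneg (Finset.sum_nonneg (h1 g hg))
      (Finset.sum_nonneg fun t ht => h2 g hg t (hSB ht))
  have hadj : ∀ t ∈ B, t - 1 ∉ B := fun t ht h => hB _ h (by rwa [sub_add_cancel])
  have hzero : ∀ g ∈ cubeFace P S B, φ g = 0 := by
    intro g hg
    have e1 : ∑ t ∈ Bᶜ, slack P g t = 0 :=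
      Finset.sum_eq_zero fun t ht => (hg t).2.2.1 (Finset.mem_compl.1 ht)
    have e2 : ∑ t ∈ S, (g (P (t - 1)) + g (P (t + 2)) - 2 * ((k : ℝ) - 1)) = 0 := by
      refine Finset.sum_eq_zero fun t ht => ?_
      rw [slack_second, (hg t).2.2.2 ht, (hg _).2.2.1 (hB t (hSB ht)),
        (hg _).2.2.1 (hadj t (hSB ht))]
      norm_num
    simp only [hφ, e1, e2, add_zero]
  refine ⟨l, Set.Subset.antisymm ?_ ?_⟩
  · intro g hg
    refine ⟨(cubeFace_subset_injectiveHull hP hB hg).1, fun y hy => ?_⟩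
    rw [hlφ, hzero g hg]
    exact hpos y hy
  · rintro g ⟨hg, hmax⟩
    have hc := slack_symm_cornerVec_mem_cubeFace (P := P) (subset_refl S) hSB
    have h3 := hmax _ (cubeFace_subset_injectiveHull hP hB hc).1
    rw [hlφ, hzero _ hc] at h3
    have n1 := Finset.sum_nonneg (h1 g hg)
    have n2 := Finset.sum_nonneg fun t ht => h2 g hg t (hSB ht)
    have z1 := (Finset.sum_eq_zero_iff_of_nonneg (h1 g hg)).1 (by simp only [hφ] at h3; linarith)
    have z2 := (Finset.sum_eq_zero_iff_of_nonneg fun t ht => h2 g hg t (hSB ht)).1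
      (by simp only [hφ] at h3; linarith)
    intro t
    by_cases ht : t ∈ B
    · have a1 := z1 _ (Finset.mem_compl.2 (hB t ht))
      have a2 := z1 _ (Finset.mem_compl.2 (hadj t ht))
      have a3 := h2 g hg t ht
      have a4 := hg (P t) (P (t + 1))
      rw [hP.dist_succ] at a4
      rw [slack_second, a1, a2] at a3
      refine ⟨by rw [slack_apply]; linarith, by linarith, fun h => (h ht).elim, fun h => ?_⟩
      have a5 := z2 t h
      rw [slack_second, a1, a2] at a5
      linarith
    · have a1 := z1 _ (Finset.mem_compl.2 ht)
      rw [a1]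
      exact ⟨le_rfl, zero_le_two, fun _ => rfl, fun h => (ht (hSB h)).elim⟩

theorem convex_hullPolyhedron : Convex ℝ (hullPolyhedron C) := by
  intro g hg h hh a b ha hb hab x y
  have h1 := mul_le_mul_of_nonneg_left (hg x y) ha
  have h2 := mul_le_mul_of_nonneg_left (hh x y) hb
  have h3 : dist x y = a * dist x y + b * dist x y := by rw [← add_mul, hab, one_mul]
  simp only [Pi.add_apply, Pi.smul_apply, smul_eq_mul]
  linarith

/-- An exposed face of `Δ` inside the hull is a cube. Let `S` be the set of slack coordinates that
are `2` on the face and `B` the set of those that are not `0` on it. Averaging two points shows that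
`B` has no consecutive elements. For each `t ∈ B \ S` the face contains a point whose coordinate `t`
lies strictly between `0` and `2`, where it can be moved both ways inside of `Δ`, so that the
exposing functional does not depend on this coordinate. -/
theorem exists_eq_cubeFace_of_isExposed (hP : IsAntipodalEnum P) {F : Set (C → ℝ)}
    (hne : F.Nonempty) (hexp : IsExposed ℝ (hullPolyhedron C) F) (hF : F ⊆ injectiveHull C) :
    ∃ S B : Finset (ZMod (2 * k + 1)), S ⊆ B ∧ IsIndep B ∧ F = cubeFace P S B := by
  classical
  have hconv : Convex ℝ F := hexp.convex convex_hullPolyhedron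
  have hcoord : ∀ g ∈ F, ∀ t, 0 ≤ slack P g t ∧ slack P g t ≤ 2 ∧
      (slack P g t = 0 ∨ slack P g (t + 1) = 0) :=
    fun g hg => (mem_injectiveHull_iff hP g).1 (hF hg)
  have hmid : ∀ g ∈ F, ∀ h ∈ F, ∃ m ∈ F, ∀ t, slack P m t = (slack P g t + slack P h t) / 2 := by
    intro g hg h hh
    refine ⟨(1 / 2 : ℝ) • g + (1 / 2 : ℝ) • h,
      hconv hg hh (by norm_num) (by norm_num) (by norm_num), fun t => ?_⟩
    simp only [slack_apply, Pi.add_apply, Pi.smul_apply, smul_eq_mul]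
    ring
  set S : Finset (ZMod (2 * k + 1)) := Finset.univ.filter fun t => ∀ g ∈ F, slack P g t = 2 with hS
  set B : Finset (ZMod (2 * k + 1)) := Finset.univ.filter fun t => ∃ g ∈ F, slack P g t ≠ 0 with hB
  have memS : ∀ t, t ∈ S ↔ ∀ g ∈ F, slack P g t = 2 := fun t => by simp [hS]
  have memB : ∀ t, t ∈ B ↔ ∃ g ∈ F, slack P g t ≠ 0 := fun t => by simp [hB]
  have hSB : S ⊆ B := by
    intro t ht
    obtain ⟨g, hg⟩ := hne
    exact (memB t).2 ⟨g, hg, by rw [(memS t).1 ht g hg]; norm_num⟩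
  have hind : IsIndep B := by
    intro t ht ht'
    obtain ⟨g, hg, hgt⟩ := (memB _).1 ht
    obtain ⟨h, hh, hht⟩ := (memB _).1 ht'
    obtain ⟨m, hm, hmt⟩ := hmid g hg h hh
    have p1 := lt_of_le_of_ne (hcoord g hg t).1 hgt.symm
    have p2 := lt_of_le_of_ne (hcoord h hh (t + 1)).1 hht.symm
    have p3 := (hcoord g hg (t + 1)).1
    have p4 := (hcoord h hh t).1
    rcases (hcoord m hm t).2.2 with h0 | h0 <;> rw [hmt] at h0 <;> linarith
  have hsub : F ⊆ cubeFace P S B := by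
    intro g hg t
    refine ⟨(hcoord g hg t).1, (hcoord g hg t).2.1, fun h => ?_, fun h => (memS t).1 h g hg⟩
    by_contra h0
    exact h ((memB t).2 ⟨g, hg, h0⟩)
  refine ⟨S, B, hSB, hind, Set.Subset.antisymm hsub ?_⟩
  obtain ⟨l, hl⟩ := hexp hne
  have hΔ := fun g (hg : g ∈ cubeFace P S B) => (cubeFace_subset_injectiveHull hP hind hg).1
  have hflat : ∀ t ∈ B, t ∉ S → l ((pairSum P).symm (Pi.single t 1)) = 0 := by
    intro t htB htS
    obtain ⟨g, hg, hgt⟩ := (memB t).1 htB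
    obtain ⟨h, hh, hht⟩ : ∃ h ∈ F, slack P h t ≠ 2 := by
      by_contra! hcon
      exact htS ((memS t).2 hcon)
    obtain ⟨m, hm, hmt⟩ := hmid g hg h hh
    have hmax : ∀ y ∈ hullPolyhedron C, l y ≤ l m := by rw [hl] at hm; exact hm.2
    have hcube : ∀ x : ℝ, 0 ≤ x → x ≤ 2 →
        (slack P).symm (Function.update (slack P m) t x) ∈ cubeFace P S B := by
      intro x hx0 hx2 u
      rw [AffineEquiv.apply_symm_apply]
      by_cases hu : u = t
      · subst hu
        rw [Function.update_self]
        exact ⟨hx0, hx2, fun h => (h htB).elim, fun h => (htS h).elim⟩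
      · rw [Function.update_of_ne hu]
        exact hsub hm u
    have hmove : ∀ x : ℝ, 0 ≤ x → x ≤ 2 →
        (x - slack P m t) * l ((pairSum P).symm (Pi.single t 1)) ≤ 0 := by
      intro x hx0 hx2
      have h1 := hmax _ (hΔ _ (hcube x hx0 hx2))
      have h2 := slack_symm_sub P (Function.update (slack P m) t x) (slack P m)
      rw [AffineEquiv.symm_apply_apply, Finset.sum_eq_single t, Function.update_self] at h2
      · have h3 := congrArg l h2
        rw [map_sub, map_smul, smul_eq_mul] at h3
        linarith
      · intro u _ hu
        rw [Function.update_of_ne hu, sub_self, zero_smul]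
      · simp
    have p1 := lt_of_le_of_ne (hcoord g hg t).1 hgt.symm
    have p2 := lt_of_le_of_ne (hcoord h hh t).2.1 hht
    have p3 := (hcoord g hg t).2.1
    have p4 := (hcoord h hh t).1
    have q1 := hmove 0 le_rfl zero_le_two
    have q2 := hmove 2 zero_le_two le_rfl
    have r := hmt t
    apply le_antisymm
    · by_contra! hc
      have := mul_pos (show 0 < 2 - slack P m t by linarith) hc
      linarith
    · by_contra! hc
      have := mul_pos_of_neg_of_neg (show 0 - slack P m t < 0 by linarith) hc
      linarith
  intro q hq
  obtain ⟨f, hf⟩ := hne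
  have hfq : l q = l f := by
    have h := slack_symm_sub P (slack P q) (slack P f)
    rw [AffineEquiv.symm_apply_apply, AffineEquiv.symm_apply_apply] at h
    have h1 := congrArg l h
    rw [map_sub, map_sum, Finset.sum_eq_zero] at h1
    · linarith
    · intro t _
      rw [map_smul, smul_eq_mul]
      by_cases htB : t ∈ B
      · by_cases htS : t ∈ S
        · rw [(hq t).2.2.2 htS, (hsub hf t).2.2.2 htS, sub_self, zero_mul]
        · rw [hflat t htB htS, mul_zero]
      · rw [(hq t).2.2.1 htB, (hsub hf t).2.2.1 htB, sub_self, zero_mul]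
  rw [hl] at hf ⊢
  exact ⟨hΔ q hq, fun y hy => (hf.2 y hy).trans_eq hfq.symm⟩

/-- The injective hull of an odd cycle is the cubical complex of the independent sets of the cycle:
its `v`-faces are the cubes `cubeFace P S B` with `|B \ S| = v`. -/
theorem isHullFace_iff (hP : IsAntipodalEnum P) (v : ℕ) (F : Set (C → ℝ)) :
    IsHullFace C v F ↔ ∃ S B : Finset (ZMod (2 * k + 1)), S ⊆ B ∧ IsIndep B ∧
      (B \ S).card = v ∧ F = cubeFace P S B := by
  constructor
  · rintro ⟨hne, hexp, hF, hdim⟩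
    obtain ⟨S, B, hSB, hB, rfl⟩ := exists_eq_cubeFace_of_isExposed hP hne hexp hF
    rw [finrank_vectorSpan_cubeFace P hSB] at hdim
    exact ⟨S, B, hSB, hB, hdim, rfl⟩
  · rintro ⟨S, B, hSB, hB, hv, rfl⟩
    exact ⟨⟨_, slack_symm_cornerVec_mem_cubeFace (subset_refl S) hSB⟩,
      isExposed_cubeFace hP hSB hB, cubeFace_subset_injectiveHull hP hB,
      (finrank_vectorSpan_cubeFace P hSB).trans hv⟩

theorem hullVertices_eq (hP : IsAntipodalEnum P) :
    hullVertices C = (fun W => (slack P).symm (cornerVec W)) '' {W | IsIndep W} := by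
  ext g
  show IsHullFace C 0 {g} ↔ _
  rw [isHullFace_iff hP]
  constructor
  · rintro ⟨S, B, hSB, hB, hv, hg⟩
    have hBS : B = S := subset_antisymm (Finset.sdiff_eq_empty_iff_subset.1
      (Finset.card_eq_zero.1 hv)) hSB
    subst hBS
    rw [cubeFace_self, Set.singleton_eq_singleton_iff] at hg
    exact ⟨B, hB, hg.symm⟩
  · rintro ⟨W, hW, rfl⟩
    exact ⟨W, W, subset_rfl, hW, by simp, (cubeFace_self W).symm⟩

theorem injectiveHull_eq_iUnion (hP : IsAntipodalEnum P) :
    injectiveHull C = ⋃ (v : ℕ) (F : Set (C → ℝ)) (_ : IsHullFace C v F), F := by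
  classical
  apply Set.Subset.antisymm
  · intro g hg
    have h := (mem_injectiveHull_iff hP g).1 hg
    -- the smallest face with `S = ∅` that contains `g`
    set B : Finset (ZMod (2 * k + 1)) := Finset.univ.filter fun t => slack P g t ≠ 0 with hB
    have memB : ∀ t, t ∈ B ↔ slack P g t ≠ 0 := fun t => by simp [hB]
    have hind : IsIndep B := by
      intro t h1 h2
      rw [memB] at h1 h2
      exact (h t).2.2.elim h1 h2
    simp only [Set.mem_iUnion]
    refine ⟨_, cubeFace P ∅ B, (isHullFace_iff hP _ _).2
      ⟨∅, B, Finset.empty_subset _, hind, rfl, rfl⟩, fun t => ⟨(h t).1, (h t).2.1, fun h => ?_, ?_⟩⟩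
    · by_contra h0
      exact h ((memB t).2 h0)
    · simp
  · exact Set.iUnion_subset fun v => Set.iUnion_subset fun F => Set.iUnion_subset fun hF => hF.2.2.1

end CubeFaces

/-! ### Partitions between two staircases and independent sets -/

/-- The diagram `μ` lies between the staircase of all boxes with `r + c ≤ k - 2` and the staircase
of all boxes with `r + c ≤ k`. -/
def InStrip (k : ℕ) (μ : YoungDiagram) : Prop :=
  (∀ r c, r + c + 2 ≤ k → (r, c) ∈ μ) ∧ ∀ r c, (r, c) ∈ μ → r + c ≤ k

/-- The boxes `(r, c)` with `r + c ∈ {k - 1, k}`, numbered from `0` to `2 k` along the zigzag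
`(0, k), (0, k - 1), (1, k - 1), (1, k - 2), …, (k, 0)`. -/
def stripBox (k n : ℕ) : ℕ × ℕ := (n / 2, k - (n + 1) / 2)

/-- The indices at which the boundary of `μ` deviates from the boundary of the staircase
`r + c ≤ k - 1`: even numbers of boxes in `μ`, odd numbers of boxes not in `μ`. -/
def deviationSet (k : ℕ) (μ : YoungDiagram) : Finset (ZMod (2 * k + 1)) :=
  Finset.univ.filter fun t => (t.val % 2 = 0 ↔ stripBox k t.val ∈ μ)

theorem natCast_mem_deviationSet {k n : ℕ} (hn : n < 2 * k + 1) (μ : YoungDiagram) :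
    (n : ZMod (2 * k + 1)) ∈ deviationSet k μ ↔ (n % 2 = 0 ↔ stripBox k n ∈ μ) := by
  simp only [deviationSet, Finset.mem_filter, Finset.mem_univ, true_and,
    ZMod.val_natCast_of_lt hn]

theorem even_mem_deviationSet {k r : ℕ} (hr : r ≤ k) (μ : YoungDiagram) :
    ((2 * r : ℕ) : ZMod (2 * k + 1)) ∈ deviationSet k μ ↔ (r, k - r) ∈ μ := by
  rw [natCast_mem_deviationSet (by omega)]
  have h : stripBox k (2 * r) = (r, k - r) := by
    simp only [stripBox, Prod.mk.injEq]
    omega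
  simp [h]

theorem odd_mem_deviationSet {k r : ℕ} (hr : r < k) (μ : YoungDiagram) :
    ((2 * r + 1 : ℕ) : ZMod (2 * k + 1)) ∈ deviationSet k μ ↔ (r, k - 1 - r) ∉ μ := by
  rw [natCast_mem_deviationSet (by omega)]
  have h : stripBox k (2 * r + 1) = (r, k - 1 - r) := by
    simp only [stripBox, Prod.mk.injEq]
    omega
  have h2 : ¬ (2 * r + 1) % 2 = 0 := by omega
  simp only [h, h2, false_iff]

/-- The even and the odd indices exhaust `ZMod (2 k + 1)`. -/
theorem exists_even_or_odd (k : ℕ) (t : ZMod (2 * k + 1)) :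
    (∃ r ≤ k, t = ((2 * r : ℕ) : ZMod (2 * k + 1))) ∨
      ∃ r < k, t = ((2 * r + 1 : ℕ) : ZMod (2 * k + 1)) := by
  have hlt := ZMod.val_lt t
  have hv := ZMod.natCast_zmod_val t
  rcases Nat.even_or_odd' t.val with ⟨r, h | h⟩
  · exact Or.inl ⟨r, by omega, by rw [← h, hv]⟩
  · exact Or.inr ⟨r, by omega, by rw [← h, hv]⟩

theorem rowLen_add_colLen_le {N : ℕ} {μ : YoungDiagram} (hμ : μ ∈ YN N) :
    μ.rowLen 0 + μ.colLen 0 ≤ N := by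
  have h : μ.rowLen 0 + μ.colLen 0 - 1 < N := hμ
  omega

theorem InStrip.mem_iff {k : ℕ} {μ : YoungDiagram} (hμ : InStrip k μ) (r c : ℕ) :
    (r, c) ∈ μ ↔ r + c + 2 ≤ k ∨
      (r + c + 1 = k ∧ ((2 * r + 1 : ℕ) : ZMod (2 * k + 1)) ∉ deviationSet k μ) ∨
      (r + c = k ∧ ((2 * r : ℕ) : ZMod (2 * k + 1)) ∈ deviationSet k μ) := by
  by_cases h1 : r + c + 2 ≤ k
  · exact ⟨fun _ => Or.inl h1, fun _ => hμ.1 r c h1⟩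
  by_cases h2 : r + c + 1 = k
  · rw [odd_mem_deviationSet (by omega), show k - 1 - r = c by omega, not_not]
    constructor
    · exact fun h => Or.inr (Or.inl ⟨h2, h⟩)
    · rintro (h | h | h)
      · omega
      · exact h.2
      · omega
  by_cases h3 : r + c = k
  · rw [even_mem_deviationSet (by omega), show k - r = c by omega]
    constructor
    · exact fun h => Or.inr (Or.inr ⟨h3, h⟩)
    · rintro (h | h | h)
      · omega
      · omega
      · exact h.2
  · constructor
    · intro h
      have := hμ.2 r c h
      omega
    · rintro (h | h | h) <;> omega

theorem InStrip.colLen_le {k : ℕ} {μ : YoungDiagram} (hμ : InStrip k μ) : μ.colLen 0 ≤ k + 1 := by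
  by_contra h
  have h1 : (k + 1, 0) ∈ μ := YoungDiagram.mem_iff_lt_colLen.2 (by omega)
  have := hμ.2 _ _ h1
  omega

theorem InStrip.rowLen_le {k : ℕ} {μ : YoungDiagram} (hμ : InStrip k μ) : μ.rowLen 0 ≤ k + 1 := by
  by_contra h
  have h1 : (0, k + 1) ∈ μ := YoungDiagram.mem_iff_lt_rowLen.2 (by omega)
  have := hμ.2 _ _ h1
  omega

theorem InStrip.le_colLen {k : ℕ} {μ : YoungDiagram} (hμ : InStrip k μ) : k ≤ μ.colLen 0 + 1 := by
  by_contra h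
  have h1 := YoungDiagram.mem_iff_lt_colLen.1 (hμ.1 (μ.colLen 0) 0 (by omega))
  omega

/-- Two boxes with consecutive numbers are neighbours, so the shape of a Young diagram excludes two
consecutive deviations. The boxes `(0, k)` and `(k, 0)` are excluded together by the bound on the
hook lengths. -/
theorem isIndep_deviationSet {k : ℕ} {μ : YoungDiagram} (hY : μ ∈ YN (2 * k + 1)) :
    IsIndep (deviationSet k μ) := by
  intro t ht ht'
  obtain ⟨r, hr, rfl⟩ | ⟨r, hr, rfl⟩ := exists_even_or_odd k t
  · rw [even_mem_deviationSet hr] at ht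
    rcases hr.lt_or_eq with h | rfl
    · rw [← Nat.cast_succ, odd_mem_deviationSet h] at ht'
      exact ht' (μ.up_left_mem le_rfl (by omega) ht)
    · rw [← Nat.cast_succ, ZMod.natCast_self,
        show (0 : ZMod (2 * r + 1)) = ((2 * 0 : ℕ) : ZMod (2 * r + 1)) by simp,
        even_mem_deviationSet (Nat.zero_le _)] at ht'
      rw [Nat.sub_self, YoungDiagram.mem_iff_lt_colLen] at ht
      rw [Nat.sub_zero, YoungDiagram.mem_iff_lt_rowLen] at ht'
      have := rowLen_add_colLen_le hY
      omega
  · rw [odd_mem_deviationSet hr] at ht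
    rw [← Nat.cast_succ, show (2 * r + 1).succ = 2 * (r + 1) by omega,
      even_mem_deviationSet (by omega)] at ht'
    exact ht (μ.up_left_mem (by omega) (by omega) ht')

/-- The Young diagram between the two staircases with a given independent set of deviations. -/
def diagramOfIndep {k : ℕ} (B : Finset (ZMod (2 * k + 1))) (hB : IsIndep B) : YoungDiagram where
  cells := (Finset.range (k + 1) ×ˢ Finset.range (k + 1)).filter fun b =>
    b.1 + b.2 + 2 ≤ k ∨ (b.1 + b.2 + 1 = k ∧ ((2 * b.1 + 1 : ℕ) : ZMod (2 * k + 1)) ∉ B) ∨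
      (b.1 + b.2 = k ∧ ((2 * b.1 : ℕ) : ZMod (2 * k + 1)) ∈ B)
  isLowerSet := by
    rintro ⟨r, c⟩ ⟨s, d⟩ hle hmem
    have h1 : s ≤ r := hle.1
    have h2 : d ≤ c := hle.2
    simp only [Finset.coe_filter, Finset.mem_product, Finset.mem_range] at hmem ⊢
    obtain ⟨-, hmem⟩ := hmem
    have hsum : r + c ≤ k := by omega
    refine ⟨⟨by omega, by omega⟩, ?_⟩
    by_cases h3 : s + d = r + c
    · obtain rfl : s = r := by omega
      obtain rfl : d = c := by omega
      exact hmem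
    by_cases h4 : s + d + 2 ≤ k
    · exact Or.inl h4
    · have h5 : r + c = k ∧ ((2 * r : ℕ) : ZMod (2 * k + 1)) ∈ B := by
        rcases hmem with h | h | h
        · omega
        · omega
        · exact h
      refine Or.inr (Or.inl ⟨by omega, fun h => ?_⟩)
      rcases h1.eq_or_lt with rfl | hlt
      · exact hB _ h5.2 (by rw [← Nat.cast_succ]; exact h)
      · obtain rfl : r = s + 1 := by omega
        exact hB _ h (by rw [← Nat.cast_succ]; exact h5.2)

theorem mem_diagramOfIndep {k : ℕ} {B : Finset (ZMod (2 * k + 1))} (hB : IsIndep B) (r c : ℕ) :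
    (r, c) ∈ diagramOfIndep B hB ↔ r + c + 2 ≤ k ∨
      (r + c + 1 = k ∧ ((2 * r + 1 : ℕ) : ZMod (2 * k + 1)) ∉ B) ∨
      (r + c = k ∧ ((2 * r : ℕ) : ZMod (2 * k + 1)) ∈ B) := by
  rw [← YoungDiagram.mem_cells]
  simp only [diagramOfIndep, Finset.mem_filter, Finset.mem_product, Finset.mem_range,
    and_iff_right_iff_imp]
  omega

theorem inStrip_diagramOfIndep {k : ℕ} {B : Finset (ZMod (2 * k + 1))} (hB : IsIndep B) :
    InStrip k (diagramOfIndep B hB) := by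
  constructor
  · intro r c h
    exact (mem_diagramOfIndep hB r c).2 (Or.inl h)
  · intro r c h
    rw [mem_diagramOfIndep hB] at h
    omega

theorem deviationSet_diagramOfIndep {k : ℕ} {B : Finset (ZMod (2 * k + 1))} (hB : IsIndep B) :
    deviationSet k (diagramOfIndep B hB) = B := by
  ext t
  obtain ⟨r, hr, rfl⟩ | ⟨r, hr, rfl⟩ := exists_even_or_odd k t
  · rw [even_mem_deviationSet hr, mem_diagramOfIndep]
    constructor
    · rintro (h | h | h)
      · omega
      · omega
      · exact h.2
    · exact fun h => Or.inr (Or.inr ⟨by omega, h⟩)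
  · rw [odd_mem_deviationSet hr, mem_diagramOfIndep, not_iff_comm]
    constructor
    · exact fun h => Or.inr (Or.inl ⟨by omega, h⟩)
    · rintro (h | h | h)
      · omega
      · exact h.2
      · omega

theorem diagramOfIndep_mem_YN {k : ℕ} {B : Finset (ZMod (2 * k + 1))} (hB : IsIndep B) :
    diagramOfIndep B hB ∈ YN (2 * k + 1) := by
  show (diagramOfIndep B hB).rowLen 0 + (diagramOfIndep B hB).colLen 0 - 1 < 2 * k + 1
  have h1 := (inStrip_diagramOfIndep hB).rowLen_le
  have h2 := (inStrip_diagramOfIndep hB).colLen_le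
  by_contra hcon
  have h3 : (0, k) ∈ diagramOfIndep B hB := YoungDiagram.mem_iff_lt_rowLen.2 (by omega)
  have h4 : (k, 0) ∈ diagramOfIndep B hB := YoungDiagram.mem_iff_lt_colLen.2 (by omega)
  have h5 := (even_mem_deviationSet (Nat.zero_le k) (diagramOfIndep B hB)).2 h3
  have h6 := (even_mem_deviationSet (le_refl k) (diagramOfIndep B hB)).2 (by rwa [Nat.sub_self])
  rw [deviationSet_diagramOfIndep] at h5 h6
  refine hB _ h6 ?_
  rw [← Nat.cast_succ, ZMod.natCast_self]
  simpa using h5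

theorem InStrip.eq_of_deviationSet_eq {k : ℕ} {μ ν : YoungDiagram} (hμ : InStrip k μ)
    (hν : InStrip k ν) (h : deviationSet k μ = deviationSet k ν) : μ = ν := by
  refine YoungDiagram.ext (Finset.ext ?_)
  rintro ⟨r, c⟩
  rw [YoungDiagram.mem_cells, YoungDiagram.mem_cells, hμ.mem_iff, hν.mem_iff, h]

theorem InStrip.of_le_of_le {k : ℕ} {μ ν κ : YoungDiagram} (hμ : InStrip k μ) (hκ : InStrip k κ)
    (h1 : μ ≤ ν) (h2 : ν ≤ κ) : InStrip k ν :=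
  ⟨fun r c h => h1 (hμ.1 r c h), fun r c h => hκ.2 r c (h2 h)⟩

/-! ### The cyclic action rotates the deviations -/

theorem InStrip.tau {k : ℕ} {μ : YN (2 * k + 1)} (hμ : InStrip k μ.1) :
    InStrip k (tau (2 * k + 1) μ).1 := by
  have h1 := hμ.colLen_le
  have h2 := hμ.le_colLen
  constructor
  · intro r c h
    refine (mem_tauDiagram μ r c).2 ?_
    rcases r with _ | r
    · exact Or.inl ⟨rfl, by omega⟩
    · exact Or.inr ⟨r, rfl, hμ.1 _ _ (by omega)⟩
  · intro r c h
    rcases (mem_tauDiagram μ r c).1 h with ⟨rfl, h'⟩ | ⟨r', rfl, h'⟩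
    · omega
    · have := hμ.2 _ _ h'
      omega

/-- The action `τ` moves the box `(r, c + 1)` to `(r + 1, c)`, two steps further on the zigzag. The
boxes `(0, k)` and `(0, k - 1)` at its start belong to the new first row, whose length `N - m - 1`
compares the number `m` of parts with `k - 1` and `k`: this is the wrap around, which exchanges
presence and absence just as it exchanges the parity of the number. -/
theorem mem_deviationSet_tau {k : ℕ} (μ : YN (2 * k + 1)) (t : ZMod (2 * k + 1)) :
    t ∈ deviationSet k (tau (2 * k + 1) μ).1 ↔ t - 2 ∈ deviationSet k μ.1 := by
  have hmem : ∀ r c, (r, c) ∈ (tau (2 * k + 1) μ).1 ↔ _ := mem_tauDiagram μ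
  obtain ⟨r, hr, rfl⟩ | ⟨r, hr, rfl⟩ := exists_even_or_odd k t
  · rw [even_mem_deviationSet hr, hmem]
    rcases r with _ | r
    · rcases Nat.eq_zero_or_pos k with rfl | hk
      · -- both sides are false: the only partition is the empty one
        constructor
        · rintro (⟨-, h⟩ | ⟨r', h, -⟩) <;> omega
        · intro h
          exact absurd ((isIndep_deviationSet μ.2).pos_of_mem h) (by omega)
      · have e : ((2 * 0 : ℕ) : ZMod (2 * k + 1)) - 2 =
            ((2 * (k - 1) + 1 : ℕ) : ZMod (2 * k + 1)) := by
          obtain ⟨l, rfl⟩ : ∃ l, k = l + 1 := ⟨k - 1, by omega⟩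
          have h := two_mul_natCast_zmod (l + 1)
          push_cast at h ⊢
          linear_combination -h
        rw [e, odd_mem_deviationSet (by omega), Nat.sub_self, YoungDiagram.mem_iff_lt_colLen]
        constructor
        · rintro (⟨-, h⟩ | ⟨r', h, -⟩) <;> omega
        · exact fun h => Or.inl ⟨rfl, by omega⟩
    · have e : ((2 * (r + 1) : ℕ) : ZMod (2 * k + 1)) - 2 = ((2 * r : ℕ) : ZMod (2 * k + 1)) := by
        push_cast; ring
      rw [e, even_mem_deviationSet (by omega)]
      constructor
      · rintro (⟨h, -⟩ | ⟨r', h, h'⟩)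
        · omega
        · obtain rfl : r = r' := by omega
          rwa [show k - (r + 1) + 1 = k - r by omega] at h'
      · intro h
        exact Or.inr ⟨r, rfl, by rwa [show k - (r + 1) + 1 = k - r by omega]⟩
  · rw [odd_mem_deviationSet hr, hmem]
    rcases r with _ | r
    · have e : ((2 * 0 + 1 : ℕ) : ZMod (2 * k + 1)) - 2 = ((2 * k : ℕ) : ZMod (2 * k + 1)) := by
        have h := two_mul_natCast_zmod k
        push_cast
        linear_combination -h
      rw [e, even_mem_deviationSet le_rfl, Nat.sub_self, YoungDiagram.mem_iff_lt_colLen]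
      constructor
      · intro h
        by_contra h'
        exact h (Or.inl ⟨rfl, by omega⟩)
      · rintro h (⟨-, h'⟩ | ⟨r', h', -⟩) <;> omega
    · have e : ((2 * (r + 1) + 1 : ℕ) : ZMod (2 * k + 1)) - 2 =
          ((2 * r + 1 : ℕ) : ZMod (2 * k + 1)) := by
        push_cast; ring
      rw [e, odd_mem_deviationSet (by omega), not_iff_not]
      constructor
      · rintro (⟨h, -⟩ | ⟨r', h, h'⟩)
        · omega
        · obtain rfl : r = r' := by omega
          rwa [show k - 1 - (r + 1) + 1 = k - 1 - r by omega] at h'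
      · intro h
        exact Or.inr ⟨r, rfl, by rwa [show k - 1 - (r + 1) + 1 = k - 1 - r by omega]⟩

theorem InStrip.tau_iterate {k : ℕ} {μ : YN (2 * k + 1)} (hμ : InStrip k μ.1) (j : ℕ) :
    InStrip k ((_root_.tau (2 * k + 1))^[j] μ).1 := by
  induction j with
  | zero => exact hμ
  | succ j ih => rw [Function.iterate_succ_apply']; exact ih.tau

theorem mem_deviationSet_tau_iterate {k : ℕ} (μ : YN (2 * k + 1)) (j : ℕ)
    (t : ZMod (2 * k + 1)) :
    t ∈ deviationSet k ((tau (2 * k + 1))^[j] μ).1 ↔ t - 2 * j ∈ deviationSet k μ.1 := by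
  induction j generalizing t with
  | zero => simp
  | succ j ih =>
    rw [Function.iterate_succ_apply', mem_deviationSet_tau, ih]
    push_cast
    rw [show t - 2 - 2 * (j : ZMod (2 * k + 1)) = t - 2 * (j + 1) by ring]

/-- Counting boxes: the small staircase has `k (k - 1) / 2` boxes; among the `2 k + 1` boxes of the
zigzag the `k` odd ones are present and the even ones absent, up to the deviations. -/
theorem InStrip.card_eq {k : ℕ} {μ : YoungDiagram} (hμ : InStrip k μ) :
    (μ.card : ℝ) = (k : ℝ) * ((k : ℝ) - 1) / 2 + k +
      (∑ n ∈ Finset.range (2 * k + 1),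
        (-1) ^ n * cornerVec (deviationSet k μ) (n : ZMod (2 * k + 1))) / 2 := by
  have hsmall : ((μ.cells.filter fun b => b.1 + b.2 + 2 ≤ k).card : ℝ) =
      (k : ℝ) * ((k : ℝ) - 1) / 2 := by
    have h1 : (μ.cells.filter fun b => b.1 + b.2 + 2 ≤ k) =
        (Finset.range (k - 1)).biUnion fun s => Finset.HasAntidiagonal.antidiagonal s := by
      ext ⟨r, c⟩
      simp only [Finset.mem_filter, YoungDiagram.mem_cells, Finset.mem_biUnion, Finset.mem_range,
        Finset.HasAntidiagonal.mem_antidiagonal]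
      constructor
      · rintro ⟨-, h⟩
        exact ⟨r + c, by omega, rfl⟩
      · rintro ⟨s, hs, h⟩
        exact ⟨hμ.1 r c (by omega), by omega⟩
    rw [h1, Finset.card_biUnion]
    · simp only [Finset.Nat.card_antidiagonal]
      rcases k with _ | k
      · simp
      · rw [Nat.add_sub_cancel]
        have h2 : ∀ n : ℕ, ((∑ s ∈ Finset.range n, (s + 1) : ℕ) : ℝ) = (n + 1) * n / 2 := by
          intro n
          induction n with
          | zero => simp
          | succ n ih => rw [Finset.sum_range_succ]; push_cast at ih ⊢; rw [ih]; ring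
        rw [h2]
        push_cast
        ring
    · intro s _ s' _ hne
      refine Finset.disjoint_left.2 ?_
      rintro ⟨r, c⟩ h h'
      rw [Finset.HasAntidiagonal.mem_antidiagonal] at h h'
      exact hne (h.symm.trans h')
  have hzig : (μ.cells.filter fun b => ¬ b.1 + b.2 + 2 ≤ k) =
      ((Finset.range (2 * k + 1)).filter fun n => stripBox k n ∈ μ).image (stripBox k) := by
    ext ⟨r, c⟩
    simp only [Finset.mem_filter, YoungDiagram.mem_cells, Finset.mem_image, Finset.mem_range]
    constructor
    · rintro ⟨h, h'⟩
      have hle := hμ.2 _ _ h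
      have hbox : stripBox k (2 * r + (k - (r + c))) = (r, c) := by
        simp only [stripBox, Prod.mk.injEq]
        omega
      exact ⟨2 * r + (k - (r + c)), ⟨by omega, by rwa [hbox]⟩, hbox⟩
    · rintro ⟨n, ⟨hn, h⟩, hbox⟩
      rw [hbox] at h
      refine ⟨h, ?_⟩
      simp only [stripBox, Prod.mk.injEq] at hbox
      omega
  have hinj : Set.InjOn (stripBox k)
      ((Finset.range (2 * k + 1)).filter fun n => stripBox k n ∈ μ : Finset ℕ) := by
    intro m hm n hn h
    simp only [Finset.coe_filter, Finset.mem_range] at hm hn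
    simp only [stripBox, Prod.mk.injEq] at h
    have := hm.1
    have := hn.1
    omega
  have hodd : ∀ l : ℕ, ∑ n ∈ Finset.range (2 * l + 1), (if n % 2 = 0 then (0 : ℝ) else 1) = l := by
    intro l
    induction l with
    | zero => simp
    | succ l ih =>
      rw [show 2 * (l + 1) + 1 = 2 * l + 1 + 1 + 1 by ring, Finset.sum_range_succ,
        Finset.sum_range_succ, ih, if_neg (by omega), if_pos (by omega)]
      push_cast
      ring
  have hterm : ∀ n ∈ Finset.range (2 * k + 1), (if stripBox k n ∈ μ then (1 : ℝ) else 0) =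
      (if n % 2 = 0 then 0 else 1) +
        (-1) ^ n * cornerVec (deviationSet k μ) (n : ZMod (2 * k + 1)) / 2 := by
    intro n hn
    rw [Finset.mem_range] at hn
    have h := natCast_mem_deviationSet hn μ
    unfold cornerVec
    by_cases h1 : n % 2 = 0
    · rw [Even.neg_one_pow (Nat.even_iff.2 h1)]
      by_cases h2 : stripBox k n ∈ μ <;> simp [h, h1, h2]
    · rw [Odd.neg_one_pow (Nat.odd_iff.2 (by omega))]
      by_cases h2 : stripBox k n ∈ μ <;> simp [h, h1, h2]
  have hcard : μ.card = (μ.cells.filter fun b => b.1 + b.2 + 2 ≤ k).card +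
      (μ.cells.filter fun b => ¬ b.1 + b.2 + 2 ≤ k).card :=
    (Finset.card_filter_add_card_filter_not _).symm
  rw [hcard, Nat.cast_add, hsmall, hzig, Finset.card_image_of_injOn hinj, Finset.card_filter]
  push_cast
  rw [Finset.sum_congr rfl hterm, Finset.sum_add_distrib, hodd, Finset.sum_div, add_assoc]

/-- The vertex function of `μ` has the slack coordinate `2` at the deviations of `μ`, and `0`
elsewhere. -/
theorem gFun_eq_slack_symm {k : ℕ} {C : Type*} (α : Fin (2 * k + 1) ≃ C) {μ : YN (2 * k + 1)}
    (hμ : InStrip k μ.1) :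
    gFun α μ = (slack (antipodalEnum α)).symm (cornerVec (deviationSet k μ.1)) := by
  ext x
  obtain ⟨t, rfl⟩ := (antipodalEnum α).surjective x
  set j : ℕ := (α.symm (antipodalEnum α t) : ℕ) with hj
  have hjt : 2 * (j : ZMod (2 * k + 1)) = -t := by
    rw [hj, antipodalEnum_apply, Equiv.symm_apply_apply, ZMod.natCast_zmod_val]
    linear_combination t * two_mul_natCast_zmod k
  rw [slack_symm_apply]
  show ((((tau (2 * k + 1))^[j] μ).1.card : ℕ) : ℝ) - (k : ℝ) * ((k : ℝ) - 1) / 2 = _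
  rw [(hμ.tau_iterate j).card_eq]
  have h : ∀ n : ℕ, cornerVec (deviationSet k ((tau (2 * k + 1))^[j] μ).1) (n : ZMod (2 * k + 1)) =
      cornerVec (deviationSet k μ.1) (t + (n : ℕ)) := by
    intro n
    unfold cornerVec
    simp only [mem_deviationSet_tau_iterate, hjt, sub_neg_eq_add, add_comm t]
  simp only [h]
  ring

/-! ### Outer rims -/

theorem InStrip.le_rowLen {k : ℕ} {μ : YoungDiagram} (hμ : InStrip k μ) : k ≤ μ.rowLen 0 + 1 := by
  by_contra h
  have h1 := YoungDiagram.mem_iff_lt_rowLen.1 (hμ.1 0 (μ.rowLen 0) (by omega))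
  omega

theorem cycleDist_of_le {N i j : ℕ} (h : i ≤ j) :
    cycleDist N i j = 2 * min ((j : ℤ) - i) (N - ((j : ℤ) - i)) := by
  unfold cycleDist
  rw [abs_of_nonneg (by omega)]

/-- If the rim of `μ` stays in the restricted strip, then `μ` lies between the two staircases. The
rim sites on the two lower sides show that `μ` has at least `k - 1` rows and columns. Then a missing
box of the small staircase, or a box outside of the large one, can be moved along its diagonal until
it gives a rim site at distance less than `2 (k - 1)`. -/
theorem inStrip_of_mem_YNcirc {k : ℕ} {μ : YN (2 * k + 1)} (hμ : μ ∈ YNcirc k) :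
    InStrip k μ.1 := by
  have hN := rowLen_add_colLen_le μ.2
  have hd : ∀ (i j : ℕ) (hij : i ≤ j ∧ j ≤ 2 * k + 1),
      IsRimPosition (2 * k + 1) μ.1 ⟨(i, j), hij⟩ →
      2 * ((k : ℤ) - 1) ≤ 2 * min ((j : ℤ) - i) ((2 * k + 1 : ℕ) - ((j : ℤ) - i)) := by
    intro i j hij hp
    have h : 2 * ((k : ℤ) - 1) ≤ cycleDist (2 * k + 1) i j := hμ ⟨_, hp, rfl⟩
    rwa [cycleDist_of_le hij.1] at h
  have hcol : k ≤ μ.1.colLen 0 + 1 := by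
    have h := hd 0 (2 * k + 1 - μ.1.colLen 0) ⟨Nat.zero_le _, Nat.sub_le _ _⟩
      ⟨?_, Or.inl rfl, ?_, ?_⟩
    · omega
    · simp only [YoungDiagram.mem_iff_lt_colLen]; omega
    · intro _; simp only; omega
    · intro _; simp only; omega
  have hrow : k ≤ μ.1.rowLen 0 + 1 := by
    have h := hd (μ.1.rowLen 0) (2 * k + 1) ⟨by omega, le_rfl⟩
      ⟨?_, Or.inr (Or.inl rfl), ?_, ?_⟩
    · omega
    · simp only [Nat.sub_self, YoungDiagram.mem_iff_lt_rowLen]; omega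
    · intro _; simp only; omega
    · intro _; simp only; omega
  have hdiag : ∀ r c, (r, c) ∈ μ.1 → (r + 1, c + 1) ∉ μ.1 → k ≤ r + c + 3 ∧ r + c ≤ k := by
    intro r c h h'
    have hr := YoungDiagram.mem_iff_lt_colLen.1 (μ.1.up_left_mem le_rfl (Nat.zero_le c) h)
    have hc := YoungDiagram.mem_iff_lt_rowLen.1 (μ.1.up_left_mem (Nat.zero_le r) le_rfl h)
    have h1 := hd (c + 1) (2 * k + 1 - (r + 1)) ⟨by omega, Nat.sub_le _ _⟩
      ⟨?_, Or.inr (Or.inr ?_), ?_, ?_⟩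
    · omega
    · rwa [show 2 * k + 1 - (2 * k + 1 - (r + 1)) = r + 1 by omega]
    · simp only
      rwa [show 2 * k + 1 - (2 * k + 1 - (r + 1)) - 1 = r by omega, Nat.add_sub_cancel]
    · intro h2; simp only at h2; omega
    · intro h2; simp only at h2; omega
  constructor
  · intro r
    induction r with
    | zero =>
      intro c h
      rw [YoungDiagram.mem_iff_lt_rowLen]
      omega
    | succ r ih =>
      intro c h
      rcases c with _ | c
      · rw [YoungDiagram.mem_iff_lt_colLen]
        omega
      · by_contra h'
        have := hdiag r c (ih c (by omega)) h'
        omega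
  · have key : ∀ n r c, (r, c) ∈ μ.1 → 2 * k + 1 ≤ r + c + n → r + c ≤ k := by
      intro n
      induction n with
      | zero =>
        intro r c h hn
        have hr := YoungDiagram.mem_iff_lt_colLen.1 (μ.1.up_left_mem le_rfl (Nat.zero_le c) h)
        have hc := YoungDiagram.mem_iff_lt_rowLen.1 (μ.1.up_left_mem (Nat.zero_le r) le_rfl h)
        omega
      | succ n ih =>
        intro r c h hn
        by_cases h' : (r + 1, c + 1) ∈ μ.1
        · have := ih (r + 1) (c + 1) h' (by omega)
          omega
        · exact (hdiag r c h h').2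
    exact fun r c h => key (2 * k + 1) r c h (by omega)

/-- The pair of points of a site, as a pair of indices in the antipodal enumeration: the point
`α_i` has the index `-2 i`. -/
def sitePair (k : ℕ) : MobiusStrip (2 * k + 1) → Sym2 (ZMod (2 * k + 1)) :=
  Quot.lift (fun p => s(-2 * (p.1.1 : ZMod (2 * k + 1)), -2 * (p.1.2 : ZMod (2 * k + 1)))) (by
    rintro _ _ ⟨i, hi⟩
    simp only [ZMod.natCast_self, Nat.cast_zero]
    exact Sym2.eq_swap)

theorem sitePair_injective (k : ℕ) : Function.Injective (sitePair k) := by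
  have hrep : ∀ s : MobiusStrip (2 * k + 1), ∃ (i j : ℕ) (h : i ≤ j) (h' : j < 2 * k + 1),
      s = site ⟨(i, j), h, h'.le⟩ := by
    rintro ⟨⟨i, j⟩, h, h'⟩
    simp only at h h'
    rcases h'.lt_or_eq with hj | rfl
    · exact ⟨i, j, h, hj, rfl⟩
    · have h1 := Quot.sound (StripGlue.glue (N := 2 * k + 1) i h)
      rcases h.lt_or_eq with hi | rfl
      · exact ⟨0, i, Nat.zero_le _, hi, h1⟩
      · exact ⟨0, 0, le_rfl, by omega,
          h1.trans (Quot.sound (StripGlue.glue (N := 2 * k + 1) 0 (Nat.zero_le _)))⟩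
  have hinj : ∀ a b : ℕ, a < 2 * k + 1 → b < 2 * k + 1 →
      -2 * (a : ZMod (2 * k + 1)) = -2 * b → a = b := by
    intro a b ha hb h
    have h1 : (a : ZMod (2 * k + 1)) = b := by
      linear_combination (k : ZMod (2 * k + 1)) * h +
        ((a : ZMod (2 * k + 1)) - b) * two_mul_natCast_zmod k
    have h2 := congrArg ZMod.val h1
    rwa [ZMod.val_natCast_of_lt ha, ZMod.val_natCast_of_lt hb] at h2
  intro s s' hss
  obtain ⟨i, j, h, hj, rfl⟩ := hrep s
  obtain ⟨i', j', h', hj', rfl⟩ := hrep s'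
  have hss : s(-2 * (i : ZMod (2 * k + 1)), -2 * (j : ZMod (2 * k + 1))) =
    s(-2 * (i' : ZMod (2 * k + 1)), -2 * (j' : ZMod (2 * k + 1))) := hss
  rw [Sym2.eq_iff] at hss
  rcases hss with ⟨h1, h2⟩ | ⟨h1, h2⟩
  · obtain rfl := hinj i i' (by omega) (by omega) h1
    obtain rfl := hinj j j' (by omega) (by omega) h2
    rfl
  · obtain rfl := hinj i j' (by omega) (by omega) h1
    obtain rfl := hinj j i' (by omega) (by omega) h2
    obtain rfl : i = j := by omega
    rfl

/-- The rim in terms of boxes `(r, c)` instead of positions `(c, N - r)`. -/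
theorem mem_sitePair_image_outerRim {k : ℕ} (μ : YN (2 * k + 1)) (x : Sym2 (ZMod (2 * k + 1))) :
    x ∈ sitePair k '' outerRim μ ↔ ∃ r c : ℕ, r + c ≤ 2 * k + 1 ∧ (r, c) ∉ μ.1 ∧
      (c = 0 ∨ r = 0 ∨ (r - 1, c - 1) ∈ μ.1) ∧ (c = 0 → μ.1.rowLen 0 + r ≤ 2 * k + 1) ∧
      (r = 0 → c + μ.1.colLen 0 ≤ 2 * k + 1) ∧
      s(-2 * (c : ZMod (2 * k + 1)), 2 * (r : ZMod (2 * k + 1))) = x := by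
  have hN := rowLen_add_colLen_le μ.2
  have hcast : ∀ r : ℕ, r ≤ 2 * k + 1 →
      -2 * ((2 * k + 1 - r : ℕ) : ZMod (2 * k + 1)) = 2 * r := by
    intro r hr
    rw [Nat.cast_sub hr, ZMod.natCast_self]
    ring
  constructor
  · rintro ⟨_, ⟨⟨⟨i, j⟩, hij, hj⟩, ⟨h1, h2, h3, h4⟩, rfl⟩, rfl⟩
    simp only at hij hj h1 h2 h3 h4
    refine ⟨2 * k + 1 - j, i, by omega, h1, ?_, ?_, ?_, ?_⟩
    · rcases h2 with h | h | h
      · exact Or.inl h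
      · exact Or.inr (Or.inl (by omega))
      · exact Or.inr (Or.inr h)
    · intro h
      have := h3 h
      omega
    · intro h
      have := h4 (by omega)
      omega
    · show s(_, _) = s(-2 * (i : ZMod (2 * k + 1)), -2 * (j : ZMod (2 * k + 1)))
      have h := hcast (2 * k + 1 - j) (Nat.sub_le _ _)
      rw [show 2 * k + 1 - (2 * k + 1 - j) = j by omega] at h
      rw [h]
  · rintro ⟨r, c, hrc, h1, h2, h3, h4, rfl⟩
    have hr : 2 * k + 1 - (2 * k + 1 - r) = r := by omega
    refine ⟨_, ⟨⟨(c, 2 * k + 1 - r), by simp only; omega, by simp only; omega⟩,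
      ⟨?_, ?_, ?_, ?_⟩, rfl⟩, ?_⟩
    · simp only [hr]
      exact h1
    · simp only [hr]
      rcases h2 with h | h | h
      · exact Or.inl h
      · exact Or.inr (Or.inl (by omega))
      · exact Or.inr (Or.inr h)
    · intro h
      have := h3 h
      simp only
      omega
    · intro h
      have := h4 (by simp only at h; omega)
      simp only
      omega
    · show s(-2 * (c : ZMod (2 * k + 1)), -2 * ((2 * k + 1 - r : ℕ) : ZMod (2 * k + 1))) = _
      rw [hcast r (by omega)]

theorem mem_YNcirc_iff {k : ℕ} (μ : YN (2 * k + 1)) : μ ∈ YNcirc k ↔ InStrip k μ.1 := by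
  refine ⟨inStrip_of_mem_YNcirc, fun hμ => ?_⟩
  have a1 := hμ.le_rowLen
  have a2 := hμ.le_colLen
  rintro _ ⟨⟨⟨i, j⟩, hij, hj⟩, ⟨h1, h2, h3, h4⟩, rfl⟩
  simp only at hij hj h1 h2 h3 h4
  show 2 * ((k : ℤ) - 1) ≤ cycleDist (2 * k + 1) i j
  rw [cycleDist_of_le hij]
  have b1 : ¬ (2 * k + 1 - j + i + 2 ≤ k) := fun h => h1 (hμ.1 _ _ h)
  have b2 : 2 * k + 1 - j + i ≤ k + 2 := by
    rcases h2 with h | h | h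
    · have := h3 h
      omega
    · have := h4 h
      omega
    · have := hμ.2 _ _ h
      omega
  push_cast
  omega

/-- The pairs of points on the rim with deviations `U`: the antipodal pair with index `t`, replaced
by the pair `t - 1`, `t + 2` at distance `2 (k - 1)` if the rim deviates at `t`. -/
def rimPair {k : ℕ} (U : Finset (ZMod (2 * k + 1))) (t : ZMod (2 * k + 1)) :
    Sym2 (ZMod (2 * k + 1)) :=
  if t ∈ U then s(t - 1, t + 2) else s(t, t + 1)

theorem rimPair_injective {k : ℕ} (U : Finset (ZMod (2 * k + 1))) :
    Function.Injective (rimPair U) := by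
  -- in either case the two indices add up to `2 t + 1`
  have hsum : ∀ t, Sym2.lift ⟨fun x y : ZMod (2 * k + 1) => x + y, add_comm⟩ (rimPair U t) =
      2 * t + 1 := by
    intro t
    unfold rimPair
    split_ifs <;> simp only [Sym2.lift_mk] <;> ring
  intro s t h
  have h1 := hsum s
  rw [h, hsum t] at h1
  linear_combination (k : ZMod (2 * k + 1)) * h1 + (t - s) * (- two_mul_natCast_zmod k)

/-- A rim position has `r + c` between `k - 1` and `k + 2`. For `r + c = k - 1` and `r + c = k` it
is a missing box of the zigzag, and its number is a deviation or not according to parity. For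
`r + c = k + 1` and `r + c = k + 2` it lies diagonally behind a box of the zigzag in `μ`, or on a
lower side of the triangular shape, where it is glued to a missing box of the other side. -/
theorem sitePair_image_outerRim {k : ℕ} {μ : YN (2 * k + 1)} (hμ : InStrip k μ.1) :
    sitePair k '' outerRim μ = Set.range (rimPair (deviationSet k μ.1)) := by
  have hk := two_mul_natCast_zmod k
  have a1 := hμ.le_rowLen
  have a2 := hμ.le_colLen
  have a3 := hμ.rowLen_le
  have a4 := hμ.colLen_le
  ext x
  rw [mem_sitePair_image_outerRim]
  constructor
  · rintro ⟨r, c, hrc, h1, h2, h3, h4, rfl⟩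
    have b1 : ¬ (r + c + 2 ≤ k) := fun h => h1 (hμ.1 _ _ h)
    have b2 : r + c ≤ k + 2 := by
      rcases h2 with h | h | h
      · have := h3 h
        omega
      · have := h4 h
        omega
      · have := hμ.2 _ _ h
        omega
    obtain h | h | h | h : r + c + 1 = k ∨ r + c = k ∨ r + c = k + 1 ∨ r + c = k + 2 := by omega
    · have hc : (c : ZMod (2 * k + 1)) = k - 1 - r := by rw [← h]; push_cast; ring
      refine ⟨((2 * r + 1 : ℕ) : ZMod (2 * k + 1)), ?_⟩
      have hm := (odd_mem_deviationSet (k := k) (r := r) (by omega) μ.1).2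
        (by rwa [show k - 1 - r = c by omega])
      rw [rimPair, if_pos hm, Sym2.eq_swap]
      push_cast
      rw [hc, show (2 * r + 1 + 2 : ZMod (2 * k + 1)) = -2 * (k - 1 - r) by linear_combination hk,
        show (2 * r + 1 - 1 : ZMod (2 * k + 1)) = 2 * r by ring]
    · have hc : (c : ZMod (2 * k + 1)) = k - r := by rw [← h]; push_cast; ring
      refine ⟨((2 * r : ℕ) : ZMod (2 * k + 1)), ?_⟩
      have hm := (even_mem_deviationSet (k := k) (r := r) (by omega) μ.1).not.2
        (by rwa [show k - r = c by omega])
      rw [rimPair, if_neg hm, Sym2.eq_swap]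
      push_cast
      rw [hc, show (2 * r + 1 : ZMod (2 * k + 1)) = -2 * (k - r) by linear_combination hk]
    · have hc : (c : ZMod (2 * k + 1)) = k + 1 - r := by
        have := congrArg (Nat.cast (R := ZMod (2 * k + 1))) h
        push_cast at this
        linear_combination this
      have hm : (2 * r - 1 : ZMod (2 * k + 1)) ∉ deviationSet k μ.1 := by
        rcases Nat.eq_zero_or_pos r with rfl | hr
        · have := h4 rfl
          rw [show (2 * (0 : ℕ) - 1 : ZMod (2 * k + 1)) = ((2 * k : ℕ) : ZMod (2 * k + 1)) by
            push_cast; linear_combination -hk, even_mem_deviationSet le_rfl, Nat.sub_self,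
            YoungDiagram.mem_iff_lt_colLen]
          omega
        rcases Nat.eq_zero_or_pos c with rfl | hc'
        · have := h3 rfl
          obtain rfl : r = k + 1 := by omega
          rw [show (2 * (k + 1 : ℕ) - 1 : ZMod (2 * k + 1)) = ((2 * 0 : ℕ) : ZMod (2 * k + 1)) by
            push_cast; linear_combination hk, even_mem_deviationSet (Nat.zero_le _), Nat.sub_zero,
            YoungDiagram.mem_iff_lt_rowLen]
          omega
        · obtain ⟨r, rfl⟩ : ∃ l, r = l + 1 := ⟨r - 1, by omega⟩
          rw [show (2 * (r + 1 : ℕ) - 1 : ZMod (2 * k + 1)) =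
            ((2 * r + 1 : ℕ) : ZMod (2 * k + 1)) by push_cast; ring,
            odd_mem_deviationSet (by omega), not_not, show k - 1 - r = c - 1 by omega]
          rcases h2 with h2 | h2 | h2
          · omega
          · omega
          · exact h2
      refine ⟨2 * r - 1, ?_⟩
      rw [rimPair, if_neg hm, sub_add_cancel, hc,
        show (2 * r - 1 : ZMod (2 * k + 1)) = -2 * (k + 1 - r) by linear_combination hk]
    · have hc : (c : ZMod (2 * k + 1)) = k + 2 - r := by
        have := congrArg (Nat.cast (R := ZMod (2 * k + 1))) h
        push_cast at this
        linear_combination this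
      have hm : (2 * r - 2 : ZMod (2 * k + 1)) ∈ deviationSet k μ.1 := by
        rcases Nat.eq_zero_or_pos r with rfl | hr
        · have := h4 rfl
          obtain ⟨l, rfl⟩ : ∃ l, k = l + 1 := ⟨k - 1, by omega⟩
          rw [show (2 * (0 : ℕ) - 2 : ZMod (2 * (l + 1) + 1)) =
            ((2 * l + 1 : ℕ) : ZMod (2 * (l + 1) + 1)) by
            push_cast at hk ⊢; linear_combination -hk, odd_mem_deviationSet (by omega),
            show l + 1 - 1 - l = 0 by omega, YoungDiagram.mem_iff_lt_colLen]
          omega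
        rcases Nat.eq_zero_or_pos c with rfl | hc'
        · have := h3 rfl
          obtain rfl : r = k + 2 := by omega
          rw [show (2 * (k + 2 : ℕ) - 2 : ZMod (2 * k + 1)) =
            ((2 * 0 + 1 : ℕ) : ZMod (2 * k + 1)) by push_cast; linear_combination hk,
            odd_mem_deviationSet (by omega), YoungDiagram.mem_iff_lt_rowLen]
          omega
        · obtain ⟨r, rfl⟩ : ∃ l, r = l + 1 := ⟨r - 1, by omega⟩
          rw [show (2 * (r + 1 : ℕ) - 2 : ZMod (2 * k + 1)) =
            ((2 * r : ℕ) : ZMod (2 * k + 1)) by push_cast; ring,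
            even_mem_deviationSet (by omega), show k - r = c - 1 by omega]
          rcases h2 with h2 | h2 | h2
          · omega
          · omega
          · exact h2
      refine ⟨2 * r - 2, ?_⟩
      rw [rimPair, if_pos hm, sub_add_cancel, hc,
        show (2 * r - 2 - 1 : ZMod (2 * k + 1)) = -2 * (k + 2 - r) by linear_combination hk]
  · rintro ⟨t, rfl⟩
    obtain ⟨r, hr, rfl⟩ | ⟨r, hr, rfl⟩ := exists_even_or_odd k t
    · by_cases hm : ((2 * r : ℕ) : ZMod (2 * k + 1)) ∈ deviationSet k μ.1
      · have hk1 := (isIndep_deviationSet μ.2).pos_of_mem hm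
        rw [rimPair, if_pos hm]
        rw [even_mem_deviationSet hr] at hm
        refine ⟨r + 1, k - r + 1, by omega, fun h => ?_, Or.inr (Or.inr hm), by omega, by omega, ?_⟩
        · have := hμ.2 _ _ h
          omega
        · push_cast [Nat.cast_sub hr]
          rw [show (-2 * (k - r + 1) : ZMod (2 * k + 1)) = 2 * r - 1 by linear_combination -hk,
            show (2 * (r + 1) : ZMod (2 * k + 1)) = 2 * r + 2 by ring]
      · rw [rimPair, if_neg hm, Sym2.eq_swap]
        rw [even_mem_deviationSet hr] at hm
        refine ⟨r, k - r, by omega, hm, ?_, by omega, by omega, ?_⟩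
        · by_cases h : k - r = 0 ∨ r = 0
          · tauto
          · exact Or.inr (Or.inr (hμ.1 _ _ (by omega)))
        · push_cast [Nat.cast_sub hr]
          rw [show (-2 * (k - r) : ZMod (2 * k + 1)) = 2 * r + 1 by linear_combination -hk]
    · obtain ⟨c, rfl⟩ : ∃ c, k = r + c + 1 := ⟨k - 1 - r, by omega⟩
      by_cases hm : ((2 * r + 1 : ℕ) : ZMod (2 * (r + c + 1) + 1)) ∈ deviationSet (r + c + 1) μ.1
      · rw [rimPair, if_pos hm, Sym2.eq_swap]
        rw [odd_mem_deviationSet hr, show r + c + 1 - 1 - r = c by omega] at hm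
        refine ⟨r, c, by omega, hm, ?_, by omega, by omega, ?_⟩
        · by_cases h : c = 0 ∨ r = 0
          · tauto
          · exact Or.inr (Or.inr (hμ.1 _ _ (by omega)))
        · push_cast at hk ⊢
          rw [show (-2 * c : ZMod (2 * (r + c + 1) + 1)) = 2 * r + 1 + 2 by linear_combination -hk,
            show (2 * r + 1 - 1 : ZMod (2 * (r + c + 1) + 1)) = 2 * r by ring]
      · rw [rimPair, if_neg hm]
        rw [odd_mem_deviationSet hr, show r + c + 1 - 1 - r = c by omega, not_not] at hm
        refine ⟨r + 1, c + 1, by omega, fun h => ?_, Or.inr (Or.inr hm), by omega, by omega, ?_⟩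
        · have := hμ.2 _ _ h
          omega
        · push_cast at hk ⊢
          rw [show (-2 * (c + 1) : ZMod (2 * (r + c + 1) + 1)) = 2 * r + 1 by
            linear_combination -hk,
            show (2 * (r + 1) : ZMod (2 * (r + c + 1) + 1)) = 2 * r + 1 + 1 by ring]

theorem ncard_outerRim {k : ℕ} {μ : YN (2 * k + 1)} (hμ : InStrip k μ.1) :
    (outerRim μ).ncard = 2 * k + 1 := by
  rw [← Set.ncard_image_of_injective _ (sitePair_injective k), sitePair_image_outerRim hμ,
    ← Set.image_univ, Set.ncard_image_of_injective _ (rimPair_injective _), Set.ncard_univ,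
    Nat.card_zmod]

/-- The rim system prescribes the slack `0` at the antipodal pairs outside of the deviations. For a
deviation `t` both neighbours are no deviations, and the equation for the pair `t - 1`, `t + 2` then
says that the slack at `t` is `2`. -/
theorem solvesRimSystem_iff {k : ℕ} {C : Type*} [MetricSpace C] (α : Fin (2 * k + 1) ≃ C)
    (hP : IsAntipodalEnum (antipodalEnum α)) {μ : YN (2 * k + 1)} (hμ : InStrip k μ.1)
    (g : C → ℝ) : SolvesRimSystem α μ g ↔ g = gFun α μ := by
  set P := antipodalEnum α with hPdef
  set U := deviationSet k μ.1 with hU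
  have hind : IsIndep U := isIndep_deviationSet μ.2
  set tight : Sym2 (ZMod (2 * k + 1)) → Prop := Sym2.lift
    ⟨fun s t => g (P s) + g (P t) = dist (P s) (P t), fun s t => by
      simp only [add_comm (g (P s)), dist_comm (P s)]⟩ with htight
  have h1 : SolvesRimSystem α μ g ↔ ∀ x ∈ sitePair k '' outerRim μ, tight x := by
    have h2 : ∀ p : Position (2 * k + 1), tight (sitePair k (site p)) ↔
        g (α (Fin.ofNat (2 * k + 1) p.1.1)) + g (α (Fin.ofNat (2 * k + 1) p.1.2)) =
          dist (α (Fin.ofNat (2 * k + 1) p.1.1)) (α (Fin.ofNat (2 * k + 1) p.1.2)) := by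
      intro p
      rw [apply_ofNat_eq_antipodalEnum, apply_ofNat_eq_antipodalEnum]
      exact Iff.rfl
    constructor
    · rintro h _ ⟨s, hs, rfl⟩
      obtain ⟨p, rfl⟩ := Quot.exists_rep s
      exact (h2 p).2 (h p hs)
    · intro h p hp
      exact (h2 p).1 (h _ ⟨_, hp, rfl⟩)
  rw [h1, sitePair_image_outerRim hμ, Set.forall_mem_range, gFun_eq_slack_symm α hμ,
    AffineEquiv.eq_symm_apply, funext_iff, ← hU, ← hPdef]
  have hout : ∀ t ∉ U, (tight (rimPair U t) ↔ slack P g t = 0) := by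
    intro t ht
    rw [rimPair, if_neg ht, slack_apply, ← hP.dist_succ t, sub_eq_zero]
    exact Iff.rfl
  have hin : ∀ t ∈ U, (tight (rimPair U t) ↔
      2 + slack P g (t - 1) + slack P g (t + 1) - slack P g t = 0) := by
    intro t ht
    rw [rimPair, if_pos ht, ← slack_second, ← hP.dist_second (hind.pos_of_mem ht), sub_eq_zero]
    exact Iff.rfl
  have hadj : ∀ t ∈ U, t - 1 ∉ U := fun t ht h => hind _ h (by rwa [sub_add_cancel])
  constructor
  · intro h t
    unfold cornerVec
    split_ifs with ht
    · have e1 := (hin t ht).1 (h t)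
      have e2 := (hout _ (hind t ht)).1 (h _)
      have e3 := (hout _ (hadj t ht)).1 (h _)
      linarith
    · exact (hout t ht).1 (h t)
  · intro h t
    by_cases ht : t ∈ U
    · rw [hin t ht, h, h, h]
      simp [cornerVec, ht, hind t ht, hadj t ht]
    · rw [hout t ht, h]
      simp [cornerVec, ht]

/-! ### Removing inner corners -/

theorem mem_innerCorners {μ : YoungDiagram} {r c : ℕ} :
    (r, c) ∈ innerCorners μ ↔ (r, c) ∈ μ ∧ (r + 1, c) ∉ μ ∧ (r, c + 1) ∉ μ := by
  simp [innerCorners]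

/-- For `ν ≤ μ` the deviations that differ are those of the boxes of `μ` outside of `ν`. -/
theorem card_deviationSet_sdiff {k : ℕ} {μ ν : YoungDiagram} (hμ : InStrip k μ)
    (hν : InStrip k ν) (hle : ν ≤ μ) :
    ((deviationSet k μ ∪ deviationSet k ν) \ (deviationSet k μ ∩ deviationSet k ν)).card =
      (μ.cells \ ν.cells).card := by
  have hmem : ∀ t, t ∈ (deviationSet k μ ∪ deviationSet k ν) \
      (deviationSet k μ ∩ deviationSet k ν) ↔ stripBox k t.val ∈ μ ∧ stripBox k t.val ∉ ν := by
    intro t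
    have h := @hle (stripBox k t.val)
    simp only [deviationSet, Finset.mem_sdiff, Finset.mem_union, Finset.mem_inter,
      Finset.mem_filter, Finset.mem_univ, true_and]
    tauto
  have hinj : Function.Injective fun t : ZMod (2 * k + 1) => stripBox k t.val := by
    intro s t h
    have hs := ZMod.val_lt s
    have ht := ZMod.val_lt t
    simp only [stripBox, Prod.mk.injEq] at h
    exact ZMod.val_injective _ (by omega)
  rw [← Finset.card_image_of_injective _ hinj]
  congr 1
  ext ⟨r, c⟩
  simp only [Finset.mem_image, hmem, Finset.mem_sdiff, YoungDiagram.mem_cells]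
  constructor
  · rintro ⟨t, h, ht⟩
    rwa [ht] at h
  · rintro ⟨h1, h2⟩
    have h3 := hμ.2 _ _ h1
    have h4 : ¬ r + c + 2 ≤ k := fun h => h2 (hν.1 _ _ h)
    have hv : ((2 * r + (k - (r + c)) : ℕ) : ZMod (2 * k + 1)).val = 2 * r + (k - (r + c)) :=
      ZMod.val_natCast_of_lt (by omega)
    have hbox : stripBox k (2 * r + (k - (r + c))) = (r, c) := by
      simp only [stripBox, Prod.mk.injEq]
      omega
    exact ⟨((2 * r + (k - (r + c)) : ℕ) : ZMod (2 * k + 1)), by rw [hv, hbox]; exact ⟨h1, h2⟩,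
      by rw [hv, hbox]⟩

theorem IsCornerRemoval.le {v : ℕ} {ν μ : YoungDiagram} (h : IsCornerRemoval v ν μ) : ν ≤ μ := by
  obtain ⟨V, -, -, hV⟩ := h
  rw [← YoungDiagram.cells_subset_iff, hV]
  exact Finset.sdiff_subset

theorem IsCornerRemoval.mem_innerCorners {v : ℕ} {ν μ : YoungDiagram} (h : IsCornerRemoval v ν μ)
    {r c : ℕ} (h1 : (r, c) ∈ μ) (h2 : (r, c) ∉ ν) : (r, c) ∈ innerCorners μ := by
  obtain ⟨V, hVμ, -, hV⟩ := h
  rw [← YoungDiagram.mem_cells, hV, Finset.mem_sdiff, not_and_not_right] at h2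
  exact hVμ (h2 h1)

theorem IsCornerRemoval.card_sdiff {v : ℕ} {ν μ : YoungDiagram} (h : IsCornerRemoval v ν μ) :
    (μ.cells \ ν.cells).card = v := by
  obtain ⟨V, hVμ, hv, hV⟩ := h
  have h1 : V ⊆ μ.cells := hVμ.trans (Finset.filter_subset _ _)
  rw [hV, Finset.sdiff_sdiff_eq_self h1, hv]

/-- A box of `μ` whose right or lower neighbour lies in `μ` is no inner corner and is not removed.
So two consecutive deviations cannot come from `μ` and `ν` together. -/
theorem IsCornerRemoval.isIndep_union {k v : ℕ} {ν μ : YoungDiagram} (h : IsCornerRemoval v ν μ)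
    (hμ : μ ∈ YN (2 * k + 1)) : IsIndep (deviationSet k μ ∪ deviationSet k ν) := by
  have hle := h.le
  have heven : ∀ r ≤ k, ((2 * r : ℕ) : ZMod (2 * k + 1)) ∈ deviationSet k μ ∪ deviationSet k ν →
      (r, k - r) ∈ μ := by
    intro r hr h
    rw [Finset.mem_union, even_mem_deviationSet hr, even_mem_deviationSet hr] at h
    exact h.elim id fun h => hle h
  have hodd : ∀ r < k,
      ((2 * r + 1 : ℕ) : ZMod (2 * k + 1)) ∈ deviationSet k μ ∪ deviationSet k ν →
      (r, k - 1 - r) ∉ ν := by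
    intro r hr h
    rw [Finset.mem_union, odd_mem_deviationSet hr, odd_mem_deviationSet hr] at h
    exact h.elim (fun h h' => h (hle h')) id
  intro t ht ht'
  obtain ⟨r, hr, rfl⟩ | ⟨r, hr, rfl⟩ := exists_even_or_odd k t
  · have h1 := heven r hr ht
    rcases hr.lt_or_eq with hlt | rfl
    · rw [← Nat.cast_succ] at ht'
      have h2 := hodd r hlt ht'
      have h3 := (_root_.mem_innerCorners.1 (h.mem_innerCorners
        (μ.up_left_mem le_rfl (by omega) h1) h2)).2.2
      rw [show k - 1 - r + 1 = k - r by omega] at h3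
      exact h3 h1
    · rw [← Nat.cast_succ, ZMod.natCast_self,
        show (0 : ZMod (2 * r + 1)) = ((2 * 0 : ℕ) : ZMod (2 * r + 1)) by simp] at ht'
      have h2 := heven 0 (Nat.zero_le _) ht'
      rw [Nat.sub_self, YoungDiagram.mem_iff_lt_colLen] at h1
      rw [Nat.sub_zero, YoungDiagram.mem_iff_lt_rowLen] at h2
      have := rowLen_add_colLen_le hμ
      omega
  · have h2 := hodd r hr ht
    rw [← Nat.cast_succ, show (2 * r + 1).succ = 2 * (r + 1) by omega] at ht'
    have h1 := heven (r + 1) (by omega) ht'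
    rw [show k - (r + 1) = k - 1 - r by omega] at h1
    exact (_root_.mem_innerCorners.1 (h.mem_innerCorners
      (μ.up_left_mem (Nat.le_succ _) le_rfl h1) h2)).2.1 h1

/-- The partitions in the interval of a corner removal are those whose deviations lie between the
common deviations of its ends and all of their deviations. -/
theorem deviationSet_image_Icc {k v : ℕ} {ν μ : YN (2 * k + 1)} (hν : InStrip k ν.1)
    (hμ : InStrip k μ.1) (h : IsCornerRemoval v ν.1 μ.1) :
    (fun κ : YN (2 * k + 1) => deviationSet k κ.1) '' Set.Icc ν μ =
      Set.Icc (deviationSet k μ.1 ∩ deviationSet k ν.1)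
        (deviationSet k μ.1 ∪ deviationSet k ν.1) := by
  have hle := h.le
  ext W
  constructor
  · rintro ⟨κ, ⟨h1, h2⟩, rfl⟩
    refine ⟨fun t => ?_, fun t => ?_⟩ <;>
    · have h3 := @h1 (stripBox k t.val)
      have h4 := @h2 (stripBox k t.val)
      simp only [deviationSet, Finset.mem_union, Finset.mem_inter,
        Finset.mem_filter, Finset.mem_univ, true_and]
      tauto
  · rintro ⟨h1, h2⟩
    have hind := h.isIndep_union μ.2
    have hW : IsIndep W := fun t ht ht' => hind t (h2 ht) (h2 ht')
    refine ⟨⟨diagramOfIndep W hW, diagramOfIndep_mem_YN hW⟩, ⟨?_, ?_⟩,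
      deviationSet_diagramOfIndep hW⟩
    · rintro ⟨r, c⟩ hb
      refine (mem_diagramOfIndep hW r c).2 ?_
      have hb' := hle hb
      rcases (hν.mem_iff r c).1 hb with h3 | ⟨h3, h4⟩ | ⟨h3, h4⟩
      · exact Or.inl h3
      · refine Or.inr (Or.inl ⟨h3, fun h5 => ?_⟩)
        rcases Finset.mem_union.1 (h2 h5) with h6 | h6
        · rw [odd_mem_deviationSet (by omega), show k - 1 - r = c by omega] at h6
          exact h6 hb'
        · exact h4 h6
      · refine Or.inr (Or.inr ⟨h3, h1 (Finset.mem_inter.2 ⟨?_, h4⟩)⟩)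
        rwa [even_mem_deviationSet (by omega), show k - r = c by omega]
    · rintro ⟨r, c⟩ hb
      refine (hμ.mem_iff r c).2 ?_
      rcases (mem_diagramOfIndep hW r c).1 hb with h3 | ⟨h3, h4⟩ | ⟨h3, h4⟩
      · exact Or.inl h3
      · refine Or.inr (Or.inl ⟨h3, fun h5 => h4 (h1 (Finset.mem_inter.2 ⟨h5, ?_⟩))⟩)
        rw [odd_mem_deviationSet (by omega), show k - 1 - r = c by omega] at h5 ⊢
        exact fun h6 => h5 (hle h6)
      · refine Or.inr (Or.inr ⟨h3, ?_⟩)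
        rcases Finset.mem_union.1 (h2 h4) with h6 | h6
        · exact h6
        · rw [even_mem_deviationSet (by omega)] at h6 ⊢
          exact hle h6

/-- Every pair `S ⊆ B` with `B` independent comes from a corner removal: put the even elements of
`B \ S` into the deviations of the large partition, the odd ones into those of the small one. -/
theorem exists_isCornerRemoval {k : ℕ} {S B : Finset (ZMod (2 * k + 1))} (hSB : S ⊆ B)
    (hB : IsIndep B) :
    ∃ ν μ : YN (2 * k + 1), InStrip k ν.1 ∧ InStrip k μ.1 ∧
      IsCornerRemoval (B \ S).card ν.1 μ.1 ∧ deviationSet k μ.1 ∩ deviationSet k ν.1 = S ∧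
      deviationSet k μ.1 ∪ deviationSet k ν.1 = B := by
  set U := B.filter fun t => t ∈ S ∨ t.val % 2 = 0 with hU
  set U' := B.filter fun t => t ∈ S ∨ ¬ t.val % 2 = 0 with hU'
  have hUB : U ⊆ B := Finset.filter_subset _ _
  have hUB' : U' ⊆ B := Finset.filter_subset _ _
  have iU : IsIndep U := fun t ht ht' => hB t (hUB ht) (hUB ht')
  have iU' : IsIndep U' := fun t ht ht' => hB t (hUB' ht) (hUB' ht')
  have hinter : U ∩ U' = S := by
    ext t
    simp only [hU, hU', Finset.mem_inter, Finset.mem_filter]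
    have := @hSB t
    tauto
  have hunion : U ∪ U' = B := by
    ext t
    simp only [hU, hU', Finset.mem_union, Finset.mem_filter]
    tauto
  have hval : ∀ n < 2 * k + 1, (n : ZMod (2 * k + 1)).val = n :=
    fun n hn => ZMod.val_natCast_of_lt hn
  have hle : diagramOfIndep U' iU' ≤ diagramOfIndep U iU := by
    rintro ⟨r, c⟩ hb
    refine (mem_diagramOfIndep iU r c).2 ?_
    rcases (mem_diagramOfIndep iU' r c).1 hb with h3 | ⟨h3, h4⟩ | ⟨h3, h4⟩
    · exact Or.inl h3
    · refine Or.inr (Or.inl ⟨h3, fun h5 => h4 ?_⟩)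
      simp only [hU, hU', Finset.mem_filter, hval (2 * r + 1) (by omega)] at h5 ⊢
      exact ⟨h5.1, Or.inr (by omega)⟩
    · refine Or.inr (Or.inr ⟨h3, ?_⟩)
      simp only [hU, hU', Finset.mem_filter, hval (2 * r) (by omega)] at h4 ⊢
      exact ⟨h4.1, Or.inr (by omega)⟩
  have hcard := card_deviationSet_sdiff (inStrip_diagramOfIndep iU) (inStrip_diagramOfIndep iU') hle
  simp only [deviationSet_diagramOfIndep, hinter, hunion] at hcard
  refine ⟨⟨_, diagramOfIndep_mem_YN iU'⟩, ⟨_, diagramOfIndep_mem_YN iU⟩,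
    inStrip_diagramOfIndep iU', inStrip_diagramOfIndep iU,
    ⟨(diagramOfIndep U iU).cells \ (diagramOfIndep U' iU').cells, ?_, hcard.symm, ?_⟩, ?_, ?_⟩
  · rintro ⟨r, c⟩ hb
    rw [Finset.mem_sdiff, YoungDiagram.mem_cells, YoungDiagram.mem_cells] at hb
    obtain ⟨h1, h2⟩ := hb
    rw [mem_innerCorners]
    refine ⟨h1, ?_⟩
    rw [mem_diagramOfIndep] at h1 h2 ⊢
    rw [mem_diagramOfIndep]
    push Not at h2
    have hodd : r + c + 1 = k → ((2 * r + 1 : ℕ) : ZMod (2 * k + 1)) ∈ B :=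
      fun h => hUB' (h2.2.1 h)
    constructor
    · rintro (h | ⟨h, h'⟩ | ⟨h, h'⟩)
      · omega
      · omega
      · refine hB _ (hodd (by omega)) ?_
        rw [← Nat.cast_succ]
        exact hUB h'
    · rintro (h | ⟨h, h'⟩ | ⟨h, h'⟩)
      · omega
      · omega
      · refine hB _ (hUB h') ?_
        rw [← Nat.cast_succ]
        exact hodd (by omega)
  · rw [Finset.sdiff_sdiff_eq_self (YoungDiagram.cells_subset_iff.2 hle)]
  · simp only [deviationSet_diagramOfIndep, hinter]
  · simp only [deviationSet_diagramOfIndep, hunion]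

/-! ### The parametrization of vertices and faces -/

theorem injOn_deviationSet (k : ℕ) :
    Set.InjOn (fun κ : YN (2 * k + 1) => deviationSet k κ.1) (YNcirc k) := by
  intro μ hμ ν hν h
  rw [mem_YNcirc_iff] at hμ hν
  exact Subtype.ext (hμ.eq_of_deviationSet_eq hν h)

theorem Icc_subset_YNcirc {k : ℕ} {ν μ : YN (2 * k + 1)} (hν : ν ∈ YNcirc k)
    (hμ : μ ∈ YNcirc k) : Set.Icc ν μ ⊆ YNcirc k := by
  intro κ hκ
  rw [mem_YNcirc_iff] at *
  exact hν.of_le_of_le hμ hκ.1 hκ.2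

theorem injOn_gFun {k : ℕ} {C : Type*} (α : Fin (2 * k + 1) ≃ C) :
    Set.InjOn (gFun α) (YNcirc k) := by
  intro μ hμ ν hν h
  rw [gFun_eq_slack_symm α ((mem_YNcirc_iff μ).1 hμ),
    gFun_eq_slack_symm α ((mem_YNcirc_iff ν).1 hν)] at h
  exact injOn_deviationSet k hμ hν (cornerVec_injective ((AffineEquiv.injective _) h))

theorem ncard_Icc_of_isCornerRemoval {k v : ℕ} {ν μ : YN (2 * k + 1)} (hν : ν ∈ YNcirc k)
    (hμ : μ ∈ YNcirc k) (h : IsCornerRemoval v ν.1 μ.1) : (Set.Icc ν μ).ncard = 2 ^ v := by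
  have hsub := Icc_subset_YNcirc hν hμ
  rw [mem_YNcirc_iff] at hν hμ
  have hSB : deviationSet k μ.1 ∩ deviationSet k ν.1 ⊆ deviationSet k μ.1 ∪ deviationSet k ν.1 :=
    Finset.inter_subset_left.trans Finset.subset_union_left
  rw [← Set.InjOn.ncard_image ((injOn_deviationSet k).mono hsub),
    deviationSet_image_Icc hν hμ h, ← Finset.coe_Icc, Set.ncard_coe_finset,
    Finset.card_Icc_finset hSB, ← Finset.card_sdiff_of_subset hSB,
    card_deviationSet_sdiff hμ hν h.le, h.card_sdiff]

/-- The vertices in the interval of a corner removal span a cube of the injective hull. -/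
theorem convexHull_gFun_image_Icc {k v : ℕ} {C : Type*} (α : Fin (2 * k + 1) ≃ C)
    {ν μ : YN (2 * k + 1)} (hν : ν ∈ YNcirc k) (hμ : μ ∈ YNcirc k)
    (h : IsCornerRemoval v ν.1 μ.1) :
    convexHull ℝ (gFun α '' Set.Icc ν μ) =
      cubeFace (antipodalEnum α) (deviationSet k μ.1 ∩ deviationSet k ν.1)
        (deviationSet k μ.1 ∪ deviationSet k ν.1) := by
  have hsub := Icc_subset_YNcirc hν hμ
  rw [cubeFace_eq_convexHull _ (Finset.inter_subset_left.trans Finset.subset_union_left),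
    ← deviationSet_image_Icc ((mem_YNcirc_iff ν).1 hν) ((mem_YNcirc_iff μ).1 hμ) h,
    Set.image_image]
  congr 1
  exact Set.image_congr fun κ hκ => gFun_eq_slack_symm α ((mem_YNcirc_iff κ).1 (hsub hκ))

theorem bijOn_gFun {k : ℕ} {C : Type*} [MetricSpace C] (α : Fin (2 * k + 1) ≃ C)
    (hP : IsAntipodalEnum (antipodalEnum α)) :
    Set.BijOn (gFun α) (YNcirc k) (hullVertices C) := by
  rw [hullVertices_eq hP]
  refine ⟨fun μ hμ => ?_, injOn_gFun α, ?_⟩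
  · exact ⟨deviationSet k μ.1, isIndep_deviationSet μ.2,
      (gFun_eq_slack_symm α ((mem_YNcirc_iff μ).1 hμ)).symm⟩
  · rintro _ ⟨W, hW, rfl⟩
    have hW : IsIndep W := hW
    have hs := inStrip_diagramOfIndep hW
    refine ⟨⟨diagramOfIndep W hW, diagramOfIndep_mem_YN hW⟩, (mem_YNcirc_iff _).2 hs, ?_⟩
    rw [gFun_eq_slack_symm α hs]
    simp only [deviationSet_diagramOfIndep]

theorem mainTheorem1 (k : ℕ) {C : Type*} [MetricSpace C] (α : Fin (2 * k + 1) ≃ C)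
    (hα : ∀ i j : Fin (2 * k + 1),
      dist (α i) (α j) = (cycleDist (2 * k + 1) (i : ℕ) (j : ℕ) : ℝ)) :
    -- the functions `g_μ` are the solutions of the linear systems given by the outer rims
    (∀ μ ∈ YNcirc k, (outerRim μ).ncard = 2 * k + 1 ∧
      ∀ g : C → ℝ, SolvesRimSystem α μ g ↔ g = gFun α μ) ∧
    -- the vertices are parametrized by the partitions in `𝕐_N°`
    Set.BijOn (gFun α) (YNcirc k) (hullVertices C) ∧
    -- the intervals that occur below have `2 ^ v` elements and give `2 ^ v` vertices
    (∀ (v : ℕ), ∀ μ' ∈ YNcirc k, ∀ μ ∈ YNcirc k, IsCornerRemoval v μ'.1 μ.1 →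
      Set.Icc μ' μ ⊆ YNcirc k ∧ (Set.Icc μ' μ).ncard = 2 ^ v ∧
        (gFun α '' Set.Icc μ' μ).ncard = 2 ^ v) ∧
    -- the `v`-faces are exactly the convex hulls of these sets of vertices
    (∀ (v : ℕ) (F : Set (C → ℝ)), IsHullFace C v F ↔
      ∃ μ' ∈ YNcirc k, ∃ μ ∈ YNcirc k, IsCornerRemoval v μ'.1 μ.1 ∧
        F = convexHull ℝ (gFun α '' Set.Icc μ' μ)) ∧
    -- `E(C_N)` is the union of its faces
    injectiveHull C = ⋃ (v : ℕ) (F : Set (C → ℝ)) (_ : IsHullFace C v F), F := by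
  have hP := isAntipodalEnum_antipodalEnum α hα
  refine ⟨fun μ hμ => ?_, bijOn_gFun α hP, fun v ν hν μ hμ h => ?_, fun v F => ?_,
    injectiveHull_eq_iUnion hP⟩
  · rw [mem_YNcirc_iff] at hμ
    exact ⟨ncard_outerRim hμ, solvesRimSystem_iff α hP hμ⟩
  · have hsub := Icc_subset_YNcirc hν hμ
    refine ⟨hsub, ncard_Icc_of_isCornerRemoval hν hμ h, ?_⟩
    rw [Set.InjOn.ncard_image ((injOn_gFun α).mono hsub)]
    exact ncard_Icc_of_isCornerRemoval hν hμ h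
  · rw [isHullFace_iff hP]
    constructor
    · rintro ⟨S, B, hSB, hB, rfl, rfl⟩
      obtain ⟨ν, μ, hν, hμ, h, h1, h2⟩ := exists_isCornerRemoval hSB hB
      rw [← mem_YNcirc_iff] at hν hμ
      refine ⟨ν, hν, μ, hμ, h, ?_⟩
      rw [convexHull_gFun_image_Icc α hν hμ h, h1, h2]
    · rintro ⟨ν, hν, μ, hμ, h, rfl⟩
      refine ⟨_, _, Finset.inter_subset_left.trans Finset.subset_union_left,
        h.isIndep_union μ.2, ?_, convexHull_gFun_image_Icc α hν hμ h⟩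
      rw [card_deviationSet_sdiff ((mem_YNcirc_iff μ).1 hμ) ((mem_YNcirc_iff ν).1 hν) h.le,
        h.card_sdiff]
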